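/- Let $\pi$ be a permutation of $[n]=\{1,\dots,n\}$, written as the sequence $\pi(1),\dots,\pi(n)$. A permutation $\tau$ \emph{contains} a permutation $\sigma$ if $\tau(1),\tau(2),\dots$ has a subsequence with the same relative order as $\sigma$; $\mathrm{Av}(321)$ is the class of permutations that do not contain $321$. The graph $G_\pi$ has vertex set $[n]$ (the elements, i.e. values, of $\pi$), and two distinct vertices $\pi(i),\pi(j)$ are adjacent if and only if $|i-j|=1$ or $|\pi(i)-\pi(j)|=1$. For even $r\ge 2$, the \emph{elementary wall of height $r$} is obtained from the $(r+1)\times(2r+2)$ grid by removing the two opposite corners $(1,2r+2)$ and $(r+1,1)$, the edges $\{(i,2j),(i+1,2j)\}$ for $i$ odd and $1\le j\le r+1$, and the edges $\{(i,2j-1),(i+1,2j-1)\}$ for $i$ even and $1\le j\le r+1$. An \emph{$r$-wall} is a subdivision of the elementary wall of height $r$; a graph contains an $r$-wall if it has one as a (not necessarily induced) subgraph. The \emph{reduction} of a sequence of $m$ distinct positive integers is the permutation of $[m]$ obtained by replacing its $i$th smallest term by $i$ for each $i$. The \emph{$k$-track} is the permutation of $[k^2]$ that is the reduction of $(1,2k,3,2k+2,5,2k+4,\dots,k^2-1,k^2+2k-2)$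 if $k$ is even, and of $(1,2k,3,2k+2,5,2k+4,\dots,k^2-k-1,k^2+k-2,k^2-k+1,k^2-k+3,\dots,k^2+k-1)$ if $k$ is odd (the $0$-track is the empty permutation). \textbf{Theorem.} There is a function $g\colon\mathbb{N}\to\mathbb{N}$, all of whose values are even and at least $2$, with $g(k)=O(k^{3/2})$, such that for every $k$, every permutation $\pi\in\mathrm{Av}(321)$ whose graph $G_\pi$ contains a $g(k)$-wall contains the $k$-track. More specifically, this holds with the constant $300$: for every $k\in\mathbb{N}$ and every even integer $r\ge 2$ with $r\ge 300k^{3/2}$, every permutation $\pi\in\mathrm{Av}(321)$ whose graph $G_\pi$ contains an $r$-wall contains the $k$-track. -/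

import Mathlib

open Filter Asymptotics

namespace PermPattern

/-- `Contains τ π`: the permutation `τ` contains the pattern `π`, i.e. `τ` has a subsequence
`τ (i 0), …, τ (i (k-1))` in the same relative order as `π`. Permutations of size `n` are
bijections of `Fin n` (positions and values are counted from `0`). -/
def Contains {n k : ℕ} (τ : Equiv.Perm (Fin n)) (π : Equiv.Perm (Fin k)) : Prop :=
  ∃ i : Fin k → Fin n, StrictMono i ∧ ∀ a b, τ (i a) < τ (i b) ↔ π a < π b

/-- The permutation `321`. -/
def perm321 : Equiv.Perm (Fin 3) := Fin.revPerm

/-- The class `Av(321)`. -/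
def Avoids321 {n : ℕ} (π : Equiv.Perm (Fin n)) : Prop := ¬ Contains π perm321

/-- The graph `G_π`: the vertices are the elements (values) of `π`, and two of them are adjacent
if their values or their positions in `π` differ by exactly one. -/
def permGraph {n : ℕ} (π : Equiv.Perm (Fin n)) : SimpleGraph (Fin n) where
  Adj x y := |((x : ℕ) : ℤ) - ((y : ℕ) : ℤ)| = 1 ∨
    |((π.symm x : ℕ) : ℤ) - ((π.symm y : ℕ) : ℤ)| = 1
  symm := ⟨fun x y h => by
    rwa [abs_sub_comm ((y : ℕ) : ℤ), abs_sub_comm ((π.symm y : ℕ) : ℤ)]⟩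
  loopless := ⟨fun x h => by simp at h⟩

/-- Vertices of the elementary wall of height `r`: the vertices `(i, j)` of the
`(r+1) × (2r+2)` grid (counted from `1`) other than the corners `(1, 2r+2)` and `(r+1, 1)`. -/
def wallVerts (r : ℕ) : Set (ℕ × ℕ) :=
  {p | 1 ≤ p.1 ∧ p.1 ≤ r + 1 ∧ 1 ≤ p.2 ∧ p.2 ≤ 2 * r + 2 ∧
    p ≠ (1, 2 * r + 2) ∧ p ≠ (r + 1, 1)}

/-- The edges of the grid that are removed: `(i, c)(i+1, c)` with `i` odd and `c` even, or with
`i` even and `c` odd. -/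
def wallRemoved (p q : ℕ × ℕ) : Prop :=
  p.2 = q.2 ∧ q.1 = p.1 + 1 ∧ ((Odd p.1 ∧ Even p.2) ∨ (Even p.1 ∧ Odd p.2))

/-- The elementary wall of height `r` (used for even `r ≥ 2`). -/
def elementaryWall (r : ℕ) : SimpleGraph (wallVerts r) where
  Adj p q :=
    |(p.1.1 : ℤ) - (q.1.1 : ℤ)| + |(p.1.2 : ℤ) - (q.1.2 : ℤ)| = 1 ∧
      ¬ wallRemoved p.1 q.1 ∧ ¬ wallRemoved q.1 p.1
  symm := ⟨fun p q h => by
    rw [abs_sub_comm (q.1.1 : ℤ), abs_sub_comm (q.1.2 : ℤ)]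
    exact ⟨h.1, h.2.2, h.2.1⟩⟩
  loopless := ⟨fun p h => by simp at h⟩

/-- `G` contains a subdivision of `H` as a (not necessarily induced) subgraph: the vertices of `H`
go to distinct branch vertices `f w` of `G`, and each edge `uv` of `H` is replaced by a path of `G`
from `f u` to `f v` (the same path, reversed, for `vu`); a path meets no branch vertices but its
two ends, and paths for different edges meet in branch vertices only. -/
def ContainsSubdivision {V W : Type*} (G : SimpleGraph V) (H : SimpleGraph W) : Prop :=
  ∃ (f : W → V) (P : ∀ u v : W, H.Adj u v → G.Walk (f u) (f v)),
    Function.Injective f ∧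
    (∀ u v h, (P u v h).IsPath) ∧
    (∀ u v (h : H.Adj u v), P v u h.symm = (P u v h).reverse) ∧
    (∀ u v h w, f w ∈ (P u v h).support → w = u ∨ w = v) ∧
    (∀ u v h u' v' h', s(u, v) ≠ s(u', v') → ∀ x, x ∈ (P u v h).support →
      x ∈ (P u' v' h').support → x ∈ Set.range f)

/-- `G` contains an `r`-wall, i.e. a subdivision of the elementary wall of height `r`. -/
def ContainsWall {V : Type*} (G : SimpleGraph V) (r : ℕ) : Prop :=
  ContainsSubdivision G (elementaryWall r)

/-- The number of terms of the sequence `ω` smaller than its term at position `i`. -/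
def rank {n : ℕ} (ω : Fin n → ℕ) (i : Fin n) : ℕ :=
  (Finset.univ.filter fun j => ω j < ω i).card

theorem rank_lt {n : ℕ} (ω : Fin n → ℕ) (i : Fin n) : rank ω i < n := by
  have h : (Finset.univ.filter fun j => ω j < ω i) ⊂ (Finset.univ : Finset (Fin n)) :=
    Finset.filter_ssubset.2 ⟨i, Finset.mem_univ _, lt_irrefl _⟩
  simpa [rank] using Finset.card_lt_card h

theorem rank_lt_rank {n : ℕ} (ω : Fin n → ℕ) {i j : Fin n} (h : ω i < ω j) :
    rank ω i < rank ω j := by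
  apply Finset.card_lt_card
  refine ⟨fun l hl => ?_, fun hs => ?_⟩
  · simp only [Finset.mem_filter, Finset.mem_univ, true_and] at hl ⊢
    exact hl.trans h
  · have : i ∈ Finset.univ.filter fun l => ω l < ω i := hs (by simpa using h)
    simp at this

/-- The reduction of a sequence of distinct natural numbers: its `i`-th smallest term is replaced
by `i` (counted from `0`). -/
noncomputable def reduction {n : ℕ} (ω : Fin n → ℕ) (hω : Function.Injective ω) :
    Equiv.Perm (Fin n) :=
  Equiv.ofBijective (fun i => (⟨rank ω i, rank_lt ω i⟩ : Fin n)) <| by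
    refine Finite.injective_iff_bijective.1 fun i j hij => ?_
    have h : rank ω i = rank ω j := congrArg Fin.val hij
    rcases lt_trichotomy (ω i) (ω j) with h1 | h1 | h1
    · exact absurd h (rank_lt_rank ω h1).ne
    · exact hω h1
    · exact absurd h (rank_lt_rank ω h1).ne'

/-- The sequence whose reduction is the `k`-track, with positions `p` counted from `0`:
`1, 2k, 3, 2k+2, 5, 2k+4, …` where, for odd `k`, the last `k` terms are instead
`k²-k+1, k²-k+3, …, k²+k-1`. -/
def trackSeq (k : ℕ) (p : Fin (k ^ 2)) : ℕ :=
  if Odd k ∧ k ^ 2 - k ≤ (p : ℕ) then (k ^ 2 - k + 1) + 2 * ((p : ℕ) - (k ^ 2 - k))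
  else if Even (p : ℕ) then (p : ℕ) + 1
  else 2 * k + ((p : ℕ) - 1)

theorem trackSeq_injective (k : ℕ) : Function.Injective (trackSeq k) := by
  intro p q h
  have e : Even (k ^ 2 - k) := by
    rw [sq, ← Nat.mul_sub_one]
    exact Nat.even_mul_pred_self k
  apply Fin.ext
  unfold trackSeq at h
  generalize (p : ℕ) = a at *
  generalize (q : ℕ) = b at *
  generalize k ^ 2 - k = m at *
  simp only [Nat.even_iff, Nat.odd_iff] at *
  split_ifs at h <;> omega

/-- The `k`-track. -/
noncomputable def track (k : ℕ) : Equiv.Perm (Fin (k ^ 2)) :=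
  reduction (trackSeq k) (trackSeq_injective k)

end PermPattern

/-!
A 321-avoiding permutation is the union of two increasing sequences, the left-to-right maxima and
the rest. Cutting both greedily into the cells of a staircase gives every element a level, odd for
the maxima and even for the others, and the interleavings of consecutive levels (by position for
levels `2i, 2i+1`, by value for levels `2i-1, 2i`) come from one horizontal coordinate `t`
(`Avoids321.exists_staircase`). So the position path runs through the blocks `{2i, 2i+1}`, each in
the order of `t`, and the value path in the same way through the blocks `{2i-1, 2i}`. In this
picture the `k`-track is a `k` by `k` grid on `k` consecutive levels, the first of them even, in
which `t` increases from the `j`-th element of each line to the `j`-th element of the next line, and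
from there to the `(j+1)`-st element of the former line (`contains_track_of_grid`).

In a window of `k` levels such a grid is sought greedily (`Reach`). If it exists, `π` contains the
track. Otherwise the chain of at most `3k` elements responsible for the failure of the greedy choice
crosses the window from left to right and separates its bottom level from its top level
(`exists_separator_of_not_reach`). Do this in windows at distance `2k`. Between two
successive separators only `O(k)` levels are involved, and these can be swept from left to right by
a line with one boundary vertex on each level (`Separates.exists_sweep`); the edges joining
different blocks cost one more vertex for each block (`exists_seam`). If there is no track, the
whole graph is therefore swept, one vertex at a time, by sets with separators of at most `16k`
vertices.

The rows and columns of a wall do not allow this: a set with a small separator contains all the rows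
that avoid the separator or is disjoint from all of them, and adding one vertex cannot take it from
one case to the other (`exists_small_of_containsWall`). So for `k ≥ 2` an `r`-wall with
`r ≥ 32k + 3` forces the `k`-track, which is stronger than the bound `300 k ^ (3 / 2)`.
-/

namespace PermPattern

/-! ### Separating sets and walls -/

/-- The set `S` meets every edge of `G` between `A` and its complement. -/
def Cuts {V : Type*} (G : SimpleGraph V) (A : Set V) (S : Finset V) : Prop :=
  ∀ x y, G.Adj x y → x ∈ A → y ∉ A → x ∈ S ∨ y ∈ S

theorem Cuts.mem_iff_of_walk {V : Type*} {G : SimpleGraph V} {A : Set V} {S : Finset V}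
    (h : Cuts G A S) {a b : V} (p : G.Walk a b) (hp : ∀ x ∈ p.support, x ∉ S) :
    ∀ x ∈ p.support, (x ∈ A ↔ a ∈ A) := by
  induction p with
  | nil => intro x hx; simp at hx; subst hx; rfl
  | @cons u v w huv q ih =>
    intro x hx
    have hu : u ∉ S := hp u (by simp)
    have hv : v ∉ S := hp v (by simp)
    have huv' : v ∈ A ↔ u ∈ A := by
      constructor
      · intro h1
        by_contra h2
        rcases h v u huv.symm h1 h2 with h3 | h3 <;> contradiction
      · intro h1
        by_contra h2
        rcases h u v huv h1 h2 with h3 | h3 <;> contradiction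
    rw [SimpleGraph.Walk.support_cons, List.mem_cons] at hx
    rcases hx with rfl | hx
    · rfl
    · rw [ih (fun y hy => hp y (by simp [hy])) x hx, huv']

/-- The vertex set `X` lies on one side of every separation whose separator it avoids. Connected
sets have this property, which is all that is used of connectedness. -/
def Unsplit {V : Type*} (G : SimpleGraph V) (X : Set V) : Prop :=
  ∀ (A : Set V) (S : Finset V), Cuts G A S → (∀ x ∈ X, x ∉ S) →
    (∀ x ∈ X, x ∈ A) ∨ ∀ x ∈ X, x ∉ A

theorem exists_avoiding {V : Type*} {m : ℕ} (R : Fin m → Set V)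
    (hR : ∀ i j x, x ∈ R i → x ∈ R j → i = j) (S : Finset V) (hS : S.card < m) :
    ∃ i, ∀ x ∈ R i, x ∉ S := by
  by_contra hcon
  push Not at hcon
  choose g hg hgS using hcon
  have := Finset.card_le_card_of_injOn (s := (Finset.univ : Finset (Fin m))) (t := S) g
    (fun i _ => hgS i) (fun i _ j _ hij => hR i j (g i) (hg i) (hij ▸ hg j))
  simp at this
  omega

/-- `A` has a separator of at most `B` vertices, and the rows `R i` avoiding the separator are
disjoint from `A`. -/
def IsSmall {V : Type*} (G : SimpleGraph V) {m : ℕ} (R : Fin m → Set V) (B : ℕ)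
    (A : Set V) : Prop :=
  ∃ S : Finset V, S.card ≤ B ∧ Cuts G A S ∧ ∀ i, (∀ x ∈ R i, x ∉ S) → ∀ x ∈ R i, x ∉ A

/-- A grid-like family of rows and columns prevents a set with a small separator from changing
from small to large when one vertex is added to it. -/
theorem IsSmall.step {V : Type*} {G : SimpleGraph V} {m B : ℕ} {R C : Fin m → Set V}
    (hR : ∀ i j x, x ∈ R i → x ∈ R j → i = j) (hC : ∀ i j x, x ∈ C i → x ∈ C j → i = j)
    (hRC : ∀ i j, ∃ x, x ∈ R i ∧ x ∈ C j) (hRu : ∀ i, Unsplit G (R i))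
    (hCu : ∀ i, Unsplit G (C i)) (hm : 2 * B + 2 ≤ m) {A A' : Set V} {v : V}
    (hA : IsSmall G R B A) (hAA' : A' ⊆ insert v A)
    (hA' : ∃ S : Finset V, S.card ≤ B ∧ Cuts G A' S) : IsSmall G R B A' := by
  classical
  obtain ⟨S, hSB, -, hS⟩ := hA
  obtain ⟨S', hSB', hcut⟩ := hA'
  refine ⟨S', hSB', hcut, ?_⟩
  obtain ⟨c, hc⟩ := exists_avoiding C hC S' (by omega)
  -- all rows avoiding `S'` lie on the side of the column `C c`
  rcases hCu c A' S' hcut hc with hin | hout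
  · exfalso
    have hcard : (S ∪ S' ∪ {v}).card < m := by
      have h1 := Finset.card_union_le (S ∪ S') {v}
      have h2 := Finset.card_union_le S S'
      simp only [Finset.card_singleton] at h1
      omega
    obtain ⟨i, hi⟩ := exists_avoiding R hR (S ∪ S' ∪ {v}) hcard
    simp only [Finset.mem_union, Finset.mem_singleton, not_or] at hi
    obtain ⟨x, hxR, hxC⟩ := hRC i c
    rcases hAA' (hin x hxC) with h | h
    · exact (hi x hxR).2 h
    · exact hS i (fun y hy => (hi y hy).1.1) x hxR h
  · intro i hi
    obtain ⟨x, hxR, hxC⟩ := hRC i c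
    rcases hRu i A' S' hcut hi with h | h
    · exact absurd (h x hxR) (hout x hxC)
    · exact h

/-- The vertices on the images of the edges of a walk `w 0, …, w N` of `H` in a subdivision of
`H`. -/
def trailSet {V W : Type*} {G : SimpleGraph V} {H : SimpleGraph W} {f : W → V}
    (P : ∀ u v : W, H.Adj u v → G.Walk (f u) (f v)) (w : ℕ → W) (N : ℕ) : Set V :=
  {x | ∃ m, m < N ∧ ∃ h : H.Adj (w m) (w (m + 1)), x ∈ (P _ _ h).support}

theorem unsplit_trailSet {V W : Type*} {G : SimpleGraph V} {H : SimpleGraph W} {f : W → V}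
    (P : ∀ u v : W, H.Adj u v → G.Walk (f u) (f v)) (w : ℕ → W) (N : ℕ)
    (hw : ∀ m < N, H.Adj (w m) (w (m + 1))) : Unsplit G (trailSet P w N) := by
  intro A S hcut hS
  have key : ∀ m (hm : m < N), ∀ x ∈ (P _ _ (hw m hm)).support, (x ∈ A ↔ f (w m) ∈ A) :=
    fun m hm => hcut.mem_iff_of_walk _ fun x hx => hS x ⟨m, hm, hw m hm, hx⟩
  have key2 : ∀ m ≤ N, (f (w m) ∈ A ↔ f (w 0) ∈ A) := by
    intro m
    induction m with
    | zero => intro _; rfl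
    | succ m ih =>
      intro hm
      rw [← ih (by omega)]
      exact key m (by omega) _ (SimpleGraph.Walk.end_mem_support _)
  by_cases h0 : f (w 0) ∈ A
  · left
    rintro x ⟨m, hm, h, hx⟩
    exact (key m hm x hx).2 ((key2 m hm.le).2 h0)
  · right
    rintro x ⟨m, hm, h, hx⟩ hxA
    exact h0 ((key2 m hm.le).1 ((key m hm x hx).1 hxA))

theorem mem_trailSet {V W : Type*} {G : SimpleGraph V} {H : SimpleGraph W} {f : W → V}
    (P : ∀ u v : W, H.Adj u v → G.Walk (f u) (f v)) (w : ℕ → W) (N : ℕ)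
    (hw : ∀ m < N, H.Adj (w m) (w (m + 1))) {m : ℕ} (hm : m ≤ N) (hN : 0 < N) :
    f (w m) ∈ trailSet P w N := by
  rcases hm.lt_or_eq with h | rfl
  · exact ⟨m, h, hw m h, SimpleGraph.Walk.start_mem_support _⟩
  · obtain ⟨m, rfl⟩ : ∃ l, m = l + 1 := ⟨m - 1, by omega⟩
    exact ⟨m, by omega, hw m (by omega), SimpleGraph.Walk.end_mem_support _⟩

theorem elementaryWall_adj_of_row {r : ℕ} {p q : wallVerts r} (h1 : p.1.1 = q.1.1)
    (h2 : q.1.2 = p.1.2 + 1 ∨ p.1.2 = q.1.2 + 1) : (elementaryWall r).Adj p q := by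
  refine ⟨?_, ?_, ?_⟩
  · rw [h1]
    rcases h2 with h | h <;> rw [h] <;> push_cast <;> simp
  · rintro ⟨h, -⟩; omega
  · rintro ⟨h, -⟩; omega

theorem elementaryWall_adj_of_column {r : ℕ} {p q : wallVerts r} (h1 : p.1.2 = q.1.2)
    (h2 : q.1.1 = p.1.1 + 1) (h3 : p.1.1 % 2 = p.1.2 % 2) : (elementaryWall r).Adj p q := by
  refine ⟨?_, ?_, ?_⟩
  · rw [h1, h2]; push_cast; simp
  · rintro ⟨-, -, h⟩
    simp only [Nat.odd_iff, Nat.even_iff] at h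
    omega
  · rintro ⟨-, h, -⟩; omega

/-- The interior row `i + 2` of the elementary wall, as a walk; it stays at its last vertex after
`2 * r + 1` steps. -/
def wallRow (r : ℕ) (i : Fin (r - 1)) (m : ℕ) : wallVerts r :=
  ⟨(i + 2, min m (2 * r + 1) + 1), by
    have := i.2
    simp only [wallVerts, Set.mem_ofPred_eq, ne_eq, Prod.mk.injEq]
    omega⟩

/-- The part inside rows `2, …, r` of the zigzag column of the elementary wall that uses the
grid columns `2 * c + 1` and `2 * c + 2`, as a walk; it stays at its last vertex after `2 * r - 3`
steps. -/
def wallColumn (r : ℕ) (c : Fin (r - 1)) (m : ℕ) : wallVerts r :=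
  ⟨(2 + min m (2 * r - 3) / 2, 2 * c + 1 + ((min m (2 * r - 3) + 1) / 2) % 2), by
    have := c.2
    simp only [wallVerts, Set.mem_ofPred_eq, ne_eq, Prod.mk.injEq]
    omega⟩

theorem wallRow_adj {r : ℕ} (i : Fin (r - 1)) {m : ℕ} (hm : m < 2 * r + 1) :
    (elementaryWall r).Adj (wallRow r i m) (wallRow r i (m + 1)) := by
  refine elementaryWall_adj_of_row rfl (Or.inl ?_)
  simp only [wallRow]
  omega

theorem wallColumn_adj {r : ℕ} (c : Fin (r - 1)) {m : ℕ} (hm : m < 2 * r - 3) :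
    (elementaryWall r).Adj (wallColumn r c m) (wallColumn r c (m + 1)) := by
  have h1 : min m (2 * r - 3) = m := by omega
  have h2 : min (m + 1) (2 * r - 3) = m + 1 := by omega
  rcases Nat.even_or_odd' m with ⟨a, rfl | rfl⟩
  · refine elementaryWall_adj_of_row ?_ ?_ <;> simp only [wallColumn, h1, h2] <;> omega
  · refine elementaryWall_adj_of_column ?_ ?_ ?_ <;> simp only [wallColumn, h1, h2] <;> omega

/-- A graph with an `r`-wall cannot be swept from `∅` to the whole vertex set, one vertex at a time,
by sets with separators of at most `(r - 3) / 2` vertices: smallness, the predicate `Q`, would be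
passed on from each set to the next. -/
theorem exists_small_of_containsWall {V : Type*} {G : SimpleGraph V} {r B : ℕ}
    (h : ContainsWall G r) (hr : 2 * B + 3 ≤ r) :
    ∃ Q : Set V → Prop, Q ∅ ∧ ¬ Q Set.univ ∧
      ∀ (A A' : Set V) (v : V), Q A → A' ⊆ insert v A →
        (∃ S : Finset V, S.card ≤ B ∧ Cuts G A' S) → Q A' := by
  obtain ⟨f, P, hf, -, -, hbr, hdis⟩ := h
  have disj : ∀ (w w' : ℕ → wallVerts r) (N N' : ℕ), (∀ m m', w m ≠ w' m') →
      ∀ x, x ∈ trailSet P w N → x ∉ trailSet P w' N' := by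
    rintro w w' N N' hne x ⟨m, hm, h, hx⟩ ⟨m', hm', h', hx'⟩
    have hne' : s(w m, w (m + 1)) ≠ s(w' m', w' (m' + 1)) := by
      intro he
      rcases Sym2.eq_iff.1 he with ⟨h1, -⟩ | ⟨h1, -⟩ <;> exact hne _ _ h1
    obtain ⟨z, rfl⟩ := hdis _ _ h _ _ h' hne' x hx hx'
    rcases hbr _ _ h z hx with h1 | h1 <;> rcases hbr _ _ h' z hx' with h2 | h2 <;>
      exact hne _ _ (h1.symm.trans h2)
  let R : Fin (r - 1) → Set V := fun i => trailSet P (wallRow r i) (2 * r + 1)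
  let C : Fin (r - 1) → Set V := fun i => trailSet P (wallColumn r i) (2 * r - 3)
  have hR : ∀ i j x, x ∈ R i → x ∈ R j → i = j := by
    intro i j x hi hj
    by_contra hij
    refine disj _ _ _ _ (fun m m' he => hij ?_) x hi hj
    have := congrArg (fun z : wallVerts r => z.1.1) he
    simp only [wallRow] at this
    exact Fin.ext (by omega)
  have hC : ∀ i j x, x ∈ C i → x ∈ C j → i = j := by
    intro i j x hi hj
    by_contra hij
    refine disj _ _ _ _ (fun m m' he => hij ?_) x hi hj
    have := congrArg (fun z : wallVerts r => z.1.2) he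
    simp only [wallColumn] at this
    exact Fin.ext (by omega)
  have hRu : ∀ i, Unsplit G (R i) :=
    fun i => unsplit_trailSet P (wallRow r i) _ fun m hm => wallRow_adj i hm
  have hCu : ∀ i, Unsplit G (C i) :=
    fun i => unsplit_trailSet P (wallColumn r i) _ fun m hm => wallColumn_adj i hm
  have hRC : ∀ i j, ∃ x, x ∈ R i ∧ x ∈ C j := by
    intro i j
    have hi := i.2
    have hj := j.2
    refine ⟨f (wallRow r i (2 * j + (i : ℕ) % 2)),
      mem_trailSet P (wallRow r i) _ (fun m hm => wallRow_adj i hm) (by omega) (by omega), ?_⟩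
    have he : wallRow r i (2 * j + (i : ℕ) % 2) = wallColumn r j (2 * i) := by
      refine Subtype.ext (Prod.ext ?_ ?_) <;> simp only [wallRow, wallColumn] <;> omega
    rw [he]
    exact mem_trailSet P (wallColumn r j) _ (fun m hm => wallColumn_adj j hm) (by omega) (by omega)
  refine ⟨IsSmall G R B, ⟨∅, by simp, fun x y _ hx => hx.elim, fun i _ x _ hx => hx.elim⟩, ?_,
    fun A A' v hA hAA' hS => hA.step hR hC hRC hRu hCu (by omega) hAA' hS⟩
  rintro ⟨S, hSB, -, hS⟩
  obtain ⟨i, hi⟩ := exists_avoiding R hR S (by omega)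
  obtain ⟨x, hx, -⟩ := hRC i i
  exact hS i hi x hx trivial

/-! ### Staircase coordinates of a 321-avoiding permutation -/

/-- If the elements are divided into levels, and the elements of each two consecutive levels are
linearly ordered consistently, then all these orders are induced by one numbering `t`: the union of
the orders is acyclic because the levels form a path. -/
theorem exists_time {V : Type*} [Fintype V] (lev : V → ℕ) (key : ℕ → V → ℕ)
    (hsame : ∀ i j x y, lev x = lev y → key i x < key i y → key j x < key j y) :
    ∃ t : V → ℕ, Function.Injective t ∧ ∀ i x y, (lev x = i ∨ lev x = i + 1) →
      (lev y = i ∨ lev y = i + 1) → key i x < key i y → t x < t y := by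
  classical
  have hmin : ∀ S : Finset V, S.Nonempty → ∃ m ∈ S, ∀ i, ∀ y ∈ S, (lev y = i ∨ lev y = i + 1) →
      (lev m = i ∨ lev m = i + 1) → ¬ key i y < key i m := by
    intro S hS
    -- candidates: elements with nothing below them on their own level and on the next one
    let T := S.filter fun x => ∀ y ∈ S, (lev y = lev x ∨ lev y = lev x + 1) →
      ¬ key (lev x) y < key (lev x) x
    have hT : T.Nonempty := by
      obtain ⟨x0, hx0, hmax⟩ := S.exists_max_image lev hS
      obtain ⟨x, hx, hxmin⟩ := (S.filter fun y => lev y = lev x0).exists_min_image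
        (key (lev x0)) ⟨x0, by simp [hx0]⟩
      simp only [Finset.mem_filter] at hx hxmin
      refine ⟨x, Finset.mem_filter.2 ⟨hx.1, fun y hy hlev => ?_⟩⟩
      have := hmax y hy
      have := hxmin y ⟨hy, by omega⟩
      rw [hx.2]
      omega
    obtain ⟨x, hxT, hxmin⟩ := T.exists_min_image lev hT
    simp only [T, Finset.mem_filter] at hxT hxmin
    refine ⟨x, hxT.1, fun i y hy hyi hxi hlt => ?_⟩
    rcases hxi with rfl | hxi
    · exact hxT.2 y hy hyi hlt
    · rcases hyi with hyi | hyi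
      · obtain ⟨z, hz, hzmin⟩ := (S.filter fun y => lev y = i).exists_min_image
          (key i) ⟨y, by simp [hy, hyi]⟩
        simp only [Finset.mem_filter] at hz hzmin
        have hzy := hzmin y ⟨hy, hyi⟩
        have := hxmin z ⟨hz.1, fun u hu hul hulz => ?_⟩
        · omega
        · rw [hz.2] at hul hulz
          rcases hul with hul | hul
          · have := hzmin u ⟨hu, hul⟩
            omega
          · exact hxT.2 u hu (Or.inl (by omega))
              (hsame i _ u x (by omega) (by omega))
      · exact hxT.2 y hy (Or.inl (by omega)) (hsame i _ y x (by omega) hlt)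
  have main : ∀ (N : ℕ) (S : Finset V), S.card = N → ∃ t : V → ℕ, Set.InjOn t S ∧
      ∀ i, ∀ x ∈ S, ∀ y ∈ S, (lev x = i ∨ lev x = i + 1) →
      (lev y = i ∨ lev y = i + 1) → key i x < key i y → t x < t y := by
    intro N
    induction N with
    | zero =>
      intro S hS
      rw [Finset.card_eq_zero] at hS
      subst hS
      exact ⟨fun _ => 0, by simp, by simp⟩
    | succ N ih =>
      intro S hS
      obtain ⟨m, hmS, hm⟩ := hmin S (Finset.card_pos.1 (by omega))
      obtain ⟨t, htinj, ht⟩ := ih (S.erase m) (by rw [Finset.card_erase_of_mem hmS]; omega)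
      refine ⟨fun x => if x = m then 0 else t x + 1, ?_, ?_⟩
      · intro x hx y hy hxy
        simp only at hxy
        split_ifs at hxy with h1 h2 h2
        · rw [h1, h2]
        · exact htinj (by simpa [h1] using hx) (by simpa [h2] using hy) (by omega)
      · intro i x hx y hy hxi hyi hlt
        have hym : y ≠ m := by
          rintro rfl
          exact hm i x hx hxi hyi hlt
        simp only [if_neg hym]
        split_ifs with h1
        · omega
        · have := ht i x (by simp [h1, hx]) y (by simp [hym, hy]) hxi hyi hlt
          omega
  obtain ⟨t, h1, h2⟩ := main _ Finset.univ rfl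
  exact ⟨t, fun x y hxy => h1 (by simp) (by simp) hxy,
    fun i x y => h2 i x (by simp) y (by simp)⟩

/-- The element `x` is a left-to-right maximum of `π`. -/
def IsUpper {n : ℕ} (π : Equiv.Perm (Fin n)) (x : Fin n) : Prop :=
  ∀ w, π.symm w < π.symm x → w < x

theorem Avoids321.not_decreasing {n : ℕ} {π : Equiv.Perm (Fin n)} (h : Avoids321 π)
    {a b c : Fin n} (hab : π.symm a < π.symm b) (hbc : π.symm b < π.symm c) (hba : b < a) :
    ¬ c < b := by
  intro hcb
  apply h
  refine ⟨![π.symm a, π.symm b, π.symm c], ?_, ?_⟩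
  · refine Fin.strictMono_iff_lt_succ.2 fun i => ?_
    fin_cases i
    · simpa using hab
    · simpa using hbc
  · intro i j
    have hca := hcb.trans hba
    fin_cases i <;> fin_cases j <;>
      simp [perm321, hba, hcb, hca, hba.le, hcb.le, hca.le]

theorem lt_iff_of_isUpper_iff {n : ℕ} {π : Equiv.Perm (Fin n)} (h : Avoids321 π) {x y : Fin n}
    (hxy : IsUpper π x ↔ IsUpper π y) : x < y ↔ π.symm x < π.symm y := by
  have key : ∀ x y : Fin n, (IsUpper π x ↔ IsUpper π y) → π.symm x < π.symm y → x < y := by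
    intro x y hxy hlt
    by_cases hy : IsUpper π y
    · exact hy x hlt
    · have hx : ¬ IsUpper π x := fun hx => hy (hxy.1 hx)
      simp only [IsUpper, not_forall] at hx
      obtain ⟨w, hw, hwx⟩ := hx
      have hne : w ≠ x := fun e => by simp [e] at hw
      have hxw : x < w := lt_of_le_of_ne (not_lt.1 hwx) hne.symm
      have := h.not_decreasing hw hlt hxw
      refine lt_of_le_of_ne (not_lt.1 this) fun e => ?_
      simp [e] at hlt
  refine ⟨fun hlt => ?_, key x y hxy⟩
  by_contra hcon
  rcases (not_lt.1 hcon).lt_or_eq with h1 | h1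
  · exact lt_asymm hlt (key y x hxy.symm h1)
  · exact hlt.ne' (π.symm.injective h1)

open Classical in
/-- The index of the cell of `x` in the greedy staircase: the length of the longest chain (for the
order by position and value) below `x` alternating between left-to-right maxima, which get odd
levels, and other elements, which get even levels. -/
noncomputable def level {n : ℕ} (π : Equiv.Perm (Fin n)) (x : Fin n) : ℕ :=
  max (if IsUpper π x then 1 else 0)
    ((Finset.univ.filter fun y => (y < x ∧ π.symm y < π.symm x) ∧
      (IsUpper π y ↔ ¬ IsUpper π x)).attach.sup fun y => level π y.1 + 1)
termination_by x.val
decreasing_by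
  have := (Finset.mem_filter.1 y.2).2.1.1
  exact this

theorem level_lt {n : ℕ} {π : Equiv.Perm (Fin n)} {x y : Fin n} (h : y < x)
    (h' : π.symm y < π.symm x) (hop : IsUpper π y ↔ ¬ IsUpper π x) : level π y < level π x := by
  classical
  rw [level.eq_1 π x]
  refine lt_max_of_lt_right (Nat.lt_of_succ_le ?_)
  have hmem : y ∈ Finset.univ.filter fun y => (y < x ∧ π.symm y < π.symm x) ∧
      (IsUpper π y ↔ ¬ IsUpper π x) := by simp [h, h', hop]
  exact Finset.le_sup (f := fun z : {z // z ∈ Finset.univ.filter fun y =>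
    (y < x ∧ π.symm y < π.symm x) ∧ (IsUpper π y ↔ ¬ IsUpper π x)} => level π z.1 + 1)
    (Finset.mem_attach _ ⟨y, hmem⟩)

theorem level_pos {n : ℕ} {π : Equiv.Perm (Fin n)} {x : Fin n} (h : IsUpper π x) :
    1 ≤ level π x := by
  rw [level.eq_1 π x]
  simp [h]

theorem level_cases {n : ℕ} (π : Equiv.Perm (Fin n)) (x : Fin n) :
    (IsUpper π x ∧ level π x = 1) ∨ (¬ IsUpper π x ∧ level π x = 0) ∨
      ∃ y, y < x ∧ π.symm y < π.symm x ∧ (IsUpper π y ↔ ¬ IsUpper π x) ∧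
        level π x = level π y + 1 := by
  classical
  rcases max_choice (if IsUpper π x then 1 else 0)
    ((Finset.univ.filter fun y => (y < x ∧ π.symm y < π.symm x) ∧
      (IsUpper π y ↔ ¬ IsUpper π x)).attach.sup fun y => level π y.1 + 1) with h | h
  · rw [← level.eq_1 π x] at h
    by_cases hx : IsUpper π x
    · exact Or.inl ⟨hx, by simpa [hx] using h⟩
    · exact Or.inr (Or.inl ⟨hx, by simpa [hx] using h⟩)
  · rw [← level.eq_1 π x] at h
    rcases (Finset.univ.filter fun y => (y < x ∧ π.symm y < π.symm x) ∧
      (IsUpper π y ↔ ¬ IsUpper π x)).attach.eq_empty_or_nonempty with he | he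
    · rw [he, Finset.sup_empty] at h
      refine Or.inr (Or.inl ⟨fun hx => ?_, h⟩)
      have := level_pos hx
      simp [h] at this
    · obtain ⟨y, -, hy⟩ := Finset.exists_mem_eq_sup _ he fun y => level π y.1 + 1
      obtain ⟨h1, h2⟩ := (Finset.mem_filter.1 y.2).2
      exact Or.inr (Or.inr ⟨y.1, h1.1, h1.2, h2, h.trans hy⟩)

theorem level_mod_two {n : ℕ} (π : Equiv.Perm (Fin n)) (x : Fin n) :
    (IsUpper π x ∧ level π x % 2 = 1) ∨ (¬ IsUpper π x ∧ level π x % 2 = 0) := by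
  induction hx : x.val using Nat.strong_induction_on generalizing x with
  | _ m ih =>
    rcases level_cases π x with ⟨h, h'⟩ | ⟨h, h'⟩ | ⟨y, hyx, -, hop, h'⟩
    · exact Or.inl ⟨h, by omega⟩
    · exact Or.inr ⟨h, by omega⟩
    · rcases ih y.val (by omega) y rfl with ⟨h1, h2⟩ | ⟨h1, h2⟩
      · exact Or.inr ⟨hop.1 h1, by omega⟩
      · exact Or.inl ⟨by tauto, by omega⟩

theorem level_mono {n : ℕ} {π : Equiv.Perm (Fin n)} {x y : Fin n} (h : y < x)
    (h' : π.symm y < π.symm x) (hs : IsUpper π y ↔ IsUpper π x) : level π y ≤ level π x := by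
  rcases level_cases π y with ⟨h1, h2⟩ | ⟨-, h2⟩ | ⟨z, h1, h2, h3, h4⟩
  · have := level_pos (hs.1 h1)
    omega
  · omega
  · have := level_lt (h1.trans h) (h2.trans h') (by rw [h3, hs])
    omega

/-- The position order refines the order of the columns `{2i, 2i+1}` of the staircase. -/
theorem level_div_le_of_symm_lt {n : ℕ} {π : Equiv.Perm (Fin n)} (h : Avoids321 π) {x y : Fin n}
    (hlt : π.symm x < π.symm y) : level π x / 2 ≤ level π y / 2 := by
  rcases level_mod_two π x with ⟨hx, hx'⟩ | ⟨hx, hx'⟩ <;>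
    rcases level_mod_two π y with ⟨hy, hy'⟩ | ⟨hy, hy'⟩
  · exact Nat.div_le_div_right (level_mono (hy x hlt) hlt (by tauto))
  · rcases level_cases π x with ⟨-, h2⟩ | ⟨h1, -⟩ | ⟨z, h1, h2, h3, h4⟩
    · omega
    · contradiction
    · have hzy : IsUpper π z ↔ IsUpper π y := by tauto
      have := level_mono ((lt_iff_of_isUpper_iff h hzy).2 (h2.trans hlt)) (h2.trans hlt) hzy
      omega
  · have := level_lt (hy x hlt) hlt (by tauto)
    omega
  · have hs : IsUpper π x ↔ IsUpper π y := by tauto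
    exact Nat.div_le_div_right (level_mono ((lt_iff_of_isUpper_iff h hs).2 hlt) hlt hs)

/-- The value order refines the order of the rows `{2i-1, 2i}` of the staircase. -/
theorem level_succ_div_le_of_lt {n : ℕ} {π : Equiv.Perm (Fin n)} (h : Avoids321 π) {x y : Fin n}
    (hlt : x < y) : (level π x + 1) / 2 ≤ (level π y + 1) / 2 := by
  rcases level_mod_two π x with ⟨hx, hx'⟩ | ⟨hx, hx'⟩ <;>
    rcases level_mod_two π y with ⟨hy, hy'⟩ | ⟨hy, hy'⟩
  · have hs : IsUpper π x ↔ IsUpper π y := by tauto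
    have := level_mono hlt ((lt_iff_of_isUpper_iff h hs).1 hlt) hs
    omega
  · have hpos : π.symm x < π.symm y := by
      by_contra hcon
      rcases (not_lt.1 hcon).lt_or_eq with h1 | h1
      · exact lt_asymm hlt (hx y h1)
      · exact hlt.ne' (π.symm.injective h1)
    have := level_lt hlt hpos (by tauto)
    omega
  · rcases level_cases π x with ⟨h1, -⟩ | ⟨-, h2⟩ | ⟨z, h1, h2, h3, h4⟩
    · contradiction
    · omega
    · have hzy : IsUpper π z ↔ IsUpper π y := by tauto
      have := level_mono (h1.trans hlt) ((lt_iff_of_isUpper_iff h hzy).1 (h1.trans hlt)) hzy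
      omega
  · have hs : IsUpper π x ↔ IsUpper π y := by tauto
    have := level_mono hlt ((lt_iff_of_isUpper_iff h hs).1 hlt) hs
    omega

/-- A linear order given by `key` is lexicographic: first by the block `(lev + ε) / 2` of two
consecutive levels, then by `t`. -/
def IsLex {V : Type*} (lev t key : V → ℕ) (ε : ℕ) : Prop :=
  ∀ x y, key x < key y ↔
    (lev x + ε) / 2 < (lev y + ε) / 2 ∨ (lev x + ε) / 2 = (lev y + ε) / 2 ∧ t x < t y

theorem isLex_of_imp {V : Type*} {lev t key : V → ℕ} {ε : ℕ} (hkey : Function.Injective key)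
    (h1 : ∀ x y, key x < key y → (lev x + ε) / 2 ≤ (lev y + ε) / 2)
    (h2 : ∀ x y, (lev x + ε) / 2 = (lev y + ε) / 2 → key x < key y → t x < t y) :
    IsLex lev t key ε := by
  intro x y
  constructor
  · intro h
    rcases (h1 x y h).lt_or_eq with h3 | h3
    · exact Or.inl h3
    · exact Or.inr ⟨h3, h2 x y h3 h⟩
  · intro h
    by_contra hcon
    rcases (not_lt.1 hcon).lt_or_eq with h3 | h3
    · have := h1 y x h3
      have := h2 y x
      omega
    · rw [hkey h3] at h
      omega

/-- A 321-avoiding permutation is drawn on a staircase of levels with a common horizontal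
coordinate `t`: positions are ordered by `(lev / 2, t)` and values by `((lev + 1) / 2, t)`. -/
theorem Avoids321.exists_staircase {n : ℕ} {π : Equiv.Perm (Fin n)} (h : Avoids321 π) :
    ∃ lev t : Fin n → ℕ, Function.Injective t ∧
      IsLex lev t (fun x => (π.symm x : ℕ)) 0 ∧ IsLex lev t (fun x => (x : ℕ)) 1 := by
  have hup : ∀ x y, level π x = level π y → (IsUpper π x ↔ IsUpper π y) := by
    intro x y hxy
    have hx := level_mod_two π x
    have hy := level_mod_two π y
    rw [hxy] at hx
    rcases hx with hx | hx <;> rcases hy with hy | hy <;> first | tauto | omega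
  obtain ⟨t, ht, hkey⟩ := exists_time (level π)
    (fun i x => if i % 2 = 0 then (π.symm x : ℕ) else (x : ℕ)) (by
      intro i j x y hxy hlt
      have := lt_iff_of_isUpper_iff h (hup x y hxy)
      rw [Fin.lt_def, Fin.lt_def] at this
      split_ifs at hlt ⊢ <;> tauto)
  refine ⟨level π, t, ht, ?_, ?_⟩
  · refine isLex_of_imp (fun x y hxy => π.symm.injective (Fin.ext hxy))
      (fun x y hlt => level_div_le_of_symm_lt h hlt) fun x y he hlt => ?_
    refine hkey (2 * (level π x / 2)) x y (by omega) (by omega) ?_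
    rw [if_pos (by omega), if_pos (by omega)]
    exact hlt
  · refine isLex_of_imp (fun x y hxy => Fin.ext hxy)
      (fun x y hlt => level_succ_div_le_of_lt h hlt) fun x y he hlt => ?_
    rcases Nat.eq_zero_or_pos ((level π x + 1) / 2) with h0 | h0
    · -- the lowest row consists of level `0` only
      have hx : level π x = 0 := by omega
      have hy : level π y = 0 := by omega
      refine hkey 0 x y (by omega) (by omega) ?_
      simp only [Nat.zero_mod, if_true]
      exact (lt_iff_of_isUpper_iff h (hup x y (by omega))).1 hlt
    · refine hkey (2 * ((level π x + 1) / 2) - 1) x y (by omega) (by omega) ?_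
      rw [if_neg (by omega), if_neg (by omega)]
      exact hlt

/-! ### Interleaved grids in a window of levels -/

/-- Membership in the greedy interleaved grid on the `k` lines of levels `b, …, b + k - 1`: for an
element `x` of line `i` and `s = 2 * j + i`, `Reach lev t b k s x` says that `x` does not precede
the greedily chosen `j`-th grid element of its line. That element has to come after the `j`-th grid
element of line `i - 1` and after the `(j-1)`-st grid element of line `i + 1`, both of which have
index `s - 1`. -/
def Reach {V : Type*} (lev t : V → ℕ) (b k : ℕ) : ℕ → V → Prop
  | 0, _ => True
  | s + 1, x => b + (s + 1) ≤ lev x ∨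
      ((lev x = b ∨ ∃ y, lev y + 1 = lev x ∧ t y < t x ∧ Reach lev t b k s y) ∧
        (lev x + 1 = b + k ∨ ∃ y, lev y = lev x + 1 ∧ t y < t x ∧ Reach lev t b k s y))

section Window

variable {V : Type*} {lev t : V → ℕ} {b k : ℕ}

theorem Reach.of_le_lev {s : ℕ} {x : V} (h : b + s ≤ lev x) : Reach lev t b k s x := by
  cases s with
  | zero => trivial
  | succ s => exact Or.inl h

theorem Reach.mono {s : ℕ} {x y : V} (h : Reach lev t b k s x) (hl : lev x = lev y)
    (ht : t x ≤ t y) : Reach lev t b k s y := by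
  cases s with
  | zero => trivial
  | succ s =>
    rcases h with h | ⟨h1, h2⟩
    · exact Or.inl (by omega)
    · refine Or.inr ⟨?_, ?_⟩
      · rcases h1 with h1 | ⟨z, hz, hzt, hzr⟩
        · exact Or.inl (by omega)
        · exact Or.inr ⟨z, by omega, by omega, hzr⟩
      · rcases h2 with h2 | ⟨z, hz, hzt, hzr⟩
        · exact Or.inl (by omega)
        · exact Or.inr ⟨z, by omega, by omega, hzr⟩

theorem Reach.of_add_two {s : ℕ} {x : V} (h : Reach lev t b k (s + 2) x) :
    Reach lev t b k s x := by
  induction s generalizing x with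
  | zero => trivial
  | succ s ih =>
    rcases h with h | ⟨h1, h2⟩
    · exact Or.inl (by omega)
    · refine Or.inr ⟨h1.imp_right ?_, h2.imp_right ?_⟩ <;>
        exact fun ⟨y, hy, hyt, hyr⟩ => ⟨y, hy, hyt, ih hyr⟩

theorem Reach.le_of_window {s : ℕ} {x : V} (hk : 2 ≤ k) (hx : b ≤ lev x) (hx' : lev x < b + k)
    (h : Reach lev t b k s x) : b + s ≤ lev x + 2 * t x := by
  induction s generalizing x with
  | zero => omega
  | succ s ih =>
    rcases h with h | ⟨h1, h2⟩
    · omega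
    · rcases h1 with h1 | ⟨y, hy, hyt, hyr⟩
      · rcases h2 with h2 | ⟨y, hy, hyt, hyr⟩
        · omega
        · by_cases hyk : lev y < b + k
          · have := ih (by omega) hyk hyr
            omega
          · omega
      · by_cases hyb : b ≤ lev y
        · have := ih hyb (by omega) hyr
          omega
        · have : lev x = b := by omega
          rcases h2 with h2 | ⟨y, hy, hyt, hyr⟩
          · omega
          · have := ih (by omega) (by omega) hyr
            omega

/-- On an adjacent level of the window, an element with the previous index has already come. -/
theorem Reach.exists_adjacent {s l : ℕ} {x : V} (h : Reach lev t b k (s + 1) x)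
    (hs : lev x < b + (s + 1)) (hl : (l + 1 = lev x ∧ b ≤ l) ∨ (l = lev x + 1 ∧ l < b + k)) :
    ∃ y, lev y = l ∧ t y < t x ∧ Reach lev t b k s y := by
  rcases h with h | ⟨h1, h2⟩
  · omega
  · rcases hl with ⟨hl, hb⟩ | ⟨hl, hb⟩
    · rcases h1 with h1 | ⟨y, hy, hyt, hyr⟩
      · omega
      · exact ⟨y, by omega, hyt, hyr⟩
    · rcases h2 with h2 | ⟨y, hy, hyt, hyr⟩
      · omega
      · exact ⟨y, by omega, hyt, hyr⟩

/-- `g x` is the largest index, among those that belong to the line of `x`, that `x` has reached. -/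
def IsHeight (lev t : V → ℕ) (b k : ℕ) (g : V → ℕ) : Prop :=
  ∀ x, b ≤ lev x → lev x < b + k → (g x + lev x + b) % 2 = 0 ∧
    ∀ s, (s + lev x + b) % 2 = 0 → (Reach lev t b k s x ↔ s ≤ g x)

theorem exists_isHeight (lev t : V → ℕ) (b : ℕ) {k : ℕ} (hk : 2 ≤ k) :
    ∃ g : V → ℕ, IsHeight lev t b k g := by
  classical
  have key : ∀ x, ∃ m, b ≤ lev x → lev x < b + k → (m + lev x + b) % 2 = 0 ∧
      ∀ s, (s + lev x + b) % 2 = 0 → (Reach lev t b k s x ↔ s ≤ m) := by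
    intro x
    by_cases hx : b ≤ lev x ∧ lev x < b + k
    swap
    · exact ⟨0, fun h h' => absurd ⟨h, h'⟩ hx⟩
    obtain ⟨i, hi⟩ : ∃ i, lev x = b + i := ⟨lev x - b, by omega⟩
    set p : ℕ → Prop := fun j => Reach lev t b k (i + 2 * j) x with hp
    have hp0 : p 0 := Reach.of_le_lev (by omega)
    have hpg : p (Nat.findGreatest p (t x)) := Nat.findGreatest_spec (Nat.zero_le _) hp0
    have hanti : ∀ d j, p (j + d) → p j := by
      intro d
      induction d with
      | zero => exact fun j h => h
      | succ d ih =>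
        exact fun j h => ih j (Reach.of_add_two (by simpa [hp, mul_add, add_assoc] using h))
    refine ⟨i + 2 * Nat.findGreatest p (t x), fun _ _ => ⟨by omega, fun s hs => ?_⟩⟩
    by_cases hsi : s < i
    · exact ⟨fun _ => by omega, fun _ => Reach.of_le_lev (by omega)⟩
    obtain ⟨j, rfl⟩ : ∃ j, s = i + 2 * j := ⟨(s - i) / 2, by omega⟩
    constructor
    · intro h
      have h1 := h.le_of_window hk hx.1 hx.2
      have := Nat.le_findGreatest (P := p) (show j ≤ t x by omega) h
      omega
    · intro h
      refine hanti (Nat.findGreatest p (t x) - j) j ?_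
      rwa [show j + (Nat.findGreatest p (t x) - j) = Nat.findGreatest p (t x) by omega]
  choose g hg using key
  exact ⟨g, hg⟩

/-- The element with index `s + 1` of a line is the first one after the elements with index `s` of
both neighbouring lines. Tracing back, always to a line whose element comes later, gives a path `p`
of lines such that everything on line `p (s + 1)` behind the element with index `s` on line `p s`
has reached `s + 1`. -/
theorem exists_critical_path (lev t : V → ℕ) (b : ℕ) {k : ℕ} (hk : 2 ≤ k) (s i : ℕ) (his : i ≤ s)
    (hik : i < k) (hpar : (s + i) % 2 = 0) :
    ∃ p : ℕ → ℕ, p s = i ∧ (∀ s' ≤ s, p s' < k ∧ (s' + p s') % 2 = 0) ∧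
      ∀ s' < s, (p (s' + 1) = p s' + 1 ∨ p s' = p (s' + 1) + 1) ∧
        ∀ y z, lev y = b + p s' → lev z = b + p (s' + 1) → Reach lev t b k s' y → t y < t z →
          Reach lev t b k (s' + 1) z := by
  induction s generalizing i with
  | zero =>
    refine ⟨fun _ => i, rfl, fun s' hs' => ⟨hik, ?_⟩, fun s' hs' => by omega⟩
    rwa [Nat.le_zero.1 hs']
  | succ s ih =>
    have hprev : ∃ i', i' ≤ s ∧ i' < k ∧ (s + i') % 2 = 0 ∧ (i = i' + 1 ∨ i' = i + 1) ∧
        ∀ y z, lev y = b + i' → lev z = b + i → Reach lev t b k s y → t y < t z →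
          Reach lev t b k (s + 1) z := by
      by_cases his' : i = s + 1
      · exact ⟨s, le_rfl, by omega, by omega, Or.inl his',
          fun y z _ hz _ _ => Reach.of_le_lev (by omega)⟩
      by_cases hi0 : i = 0
      · exact ⟨1, by omega, by omega, by omega, Or.inr (by omega), fun y z hy hz hr hlt =>
          Or.inr ⟨Or.inl (by omega), Or.inr ⟨y, by omega, hlt, hr⟩⟩⟩
      by_cases hi1 : i + 1 = k
      · exact ⟨i - 1, by omega, by omega, by omega, Or.inl (by omega), fun y z hy hz hr hlt =>
          Or.inr ⟨Or.inr ⟨y, by omega, hlt, hr⟩, Or.inl (by omega)⟩⟩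
      by_cases hup : ∀ y z, lev y = b + (i + 1) → lev z = b + i → Reach lev t b k s y → t y < t z →
          Reach lev t b k (s + 1) z
      · exact ⟨i + 1, by omega, by omega, by omega, Or.inr rfl, hup⟩
      · refine ⟨i - 1, by omega, by omega, by omega, Or.inl (by omega), ?_⟩
        push Not at hup
        obtain ⟨y', z', hy', hz', hr', hlt', hn'⟩ := hup
        intro y z hy hz hr hlt
        rcases le_total (t z) (t z') with h | h
        · refine absurd (Or.inr ⟨Or.inr ⟨y, by omega, by omega, hr⟩,
            Or.inr ⟨y', by omega, hlt', hr'⟩⟩) hn'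
        · exact Or.inr ⟨Or.inr ⟨y, by omega, hlt, hr⟩, Or.inr ⟨y', by omega, by omega, hr'⟩⟩
    obtain ⟨i', h1, h2, h3, h4, h5⟩ := hprev
    obtain ⟨p, hp, hp1, hp2⟩ := ih i' h1 h2 h3
    refine ⟨fun s' => if s' ≤ s then p s' else i, by simp, fun s' hs' => ?_, fun s' hs' => ?_⟩
    · by_cases h : s' ≤ s
      · simpa [h] using hp1 s' h
      · have : s' = s + 1 := by omega
        subst this
        simp [hik, hpar]
    · rcases (Nat.le_of_lt_succ hs').lt_or_eq with h | rfl
      · simpa [h.le, Nat.succ_le_of_lt h] using hp2 s' h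
      · simpa [hp] using ⟨h4, h5⟩

/-- The critical path of the last element of a `k` by `k` grid, prolonged so that it leaves the
window upwards. -/
theorem exists_infinite_critical_path (lev t : V → ℕ) (b : ℕ) {k : ℕ} (hk : 2 ≤ k) :
    ∃ p : ℕ → ℕ, (∀ s, (s + p s) % 2 = 0) ∧ (∀ s, p (s + 1) = p s + 1 ∨ p s = p (s + 1) + 1) ∧
      (∀ s, s < 3 * k → p s < k) ∧ (∀ s, p s < k → s < 3 * k) ∧
      ∀ s y z, lev y = b + p s → lev z = b + p (s + 1) → lev z < b + k →
        Reach lev t b k s y → t y < t z → Reach lev t b k (s + 1) z := by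
  obtain ⟨q, hq, hq1, hq2⟩ := exists_critical_path lev t b hk (3 * k - 1) (k - 1) (by omega)
    (by omega) (by omega)
  obtain ⟨p, hp1, hp2⟩ : ∃ p : ℕ → ℕ, (∀ s, s ≤ 3 * k - 1 → p s = q s) ∧
      ∀ s, 3 * k - 1 ≤ s → p s = (k - 1) + (s - (3 * k - 1)) := by
    refine ⟨fun s => if s ≤ 3 * k - 1 then q s else (k - 1) + (s - (3 * k - 1)), ?_, ?_⟩
    · intro s hs
      simp [hs]
    · intro s hs
      rcases hs.lt_or_eq with h | rfl
      · simp [h]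
      · simp [hq]
  have hpar : ∀ s, (s + p s) % 2 = 0 := by
    intro s
    rcases le_total s (3 * k - 1) with h | h
    · rw [hp1 s h]
      exact (hq1 s h).2
    · have := hp2 s h
      omega
  have hstep : ∀ s, p (s + 1) = p s + 1 ∨ p s = p (s + 1) + 1 := by
    intro s
    by_cases h : s < 3 * k - 1
    · rw [hp1 s h.le, hp1 (s + 1) h]
      exact (hq2 s h).1
    · have := hp2 s (by omega)
      have := hp2 (s + 1) (by omega)
      omega
  have hlast : ∀ s, p s < k → s < 3 * k := by
    intro s hs
    by_contra h
    have := hp2 s (by omega)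
    omega
  refine ⟨p, hpar, hstep, fun s hs => ?_, hlast, fun s y z hy hz hzk hr hlt => ?_⟩
  · rw [hp1 s (by omega)]
    exact (hq1 s (by omega)).1
  · have hs := hlast (s + 1) (by omega)
    rw [hp1 s (by omega)] at hy
    rw [hp1 (s + 1) (by omega)] at hz
    exact (hq2 s (by omega)).2 y z hy hz hr hlt

/-- `u` and `v` are on the same level or on adjacent levels, `u` before `v`, and no element of
their levels is between them. -/
def Consecutive (lev t : V → ℕ) (u v : V) : Prop :=
  t u < t v ∧ lev u ≤ lev v + 1 ∧ lev v ≤ lev u + 1 ∧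
    ∀ w, (lev w = lev u ∨ lev w = lev v) → t u < t w → ¬ t w < t v

theorem Consecutive.le_of_lt {u v w : V} (h : Consecutive lev t u v)
    (hw : lev w = lev u ∨ lev w = lev v) (hwt : t w < t v) : t w ≤ t u := by
  by_contra hcon
  exact h.2.2.2 w hw (by omega) hwt

theorem IsHeight.reach {g : V → ℕ} (hg : IsHeight lev t b k g) {x : V} (hx : b ≤ lev x)
    (hx' : lev x < b + k) : Reach lev t b k (g x) x :=
  ((hg x hx hx').2 _ (hg x hx hx').1).2 le_rfl

theorem IsHeight.lev_le {g : V → ℕ} (hg : IsHeight lev t b k g) {x : V} (hx : b ≤ lev x)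
    (hx' : lev x < b + k) : lev x ≤ b + g x := by
  have := ((hg x hx hx').2 (lev x - b) (by omega)).1 (Reach.of_le_lev (by omega))
  omega

theorem IsHeight.of_consecutive_of_eq {g : V → ℕ} (hg : IsHeight lev t b k g) (hk : 2 ≤ k)
    {u v : V} (h : Consecutive lev t u v) (hu : b ≤ lev u) (hu' : lev u < b + k)
    (hl : lev u = lev v) : g v = g u ∨ g v = g u + 2 := by
  obtain ⟨hgu, hru⟩ := hg u hu hu'
  obtain ⟨hgv, hrv⟩ := hg v (by omega) (by omega)
  have hrgv := hg.reach (x := v) (by omega) (by omega)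
  have hgub := hg.lev_le hu hu'
  have h1 : g u ≤ g v := (hrv _ (by omega)).1 ((hg.reach hu hu').mono hl h.1.le)
  have h2 : g v ≤ g u + 2 := by
    by_contra hcon
    -- two steps back in the recursion lead to the level of `u` and `v` again
    obtain ⟨s, hs⟩ : ∃ s, g v = s + 1 + 1 := ⟨g v - 2, by omega⟩
    rw [hs] at hrgv
    obtain ⟨l, hl1, hl2⟩ : ∃ l, ((l + 1 = lev v ∧ b ≤ l) ∨ (l = lev v + 1 ∧ l < b + k)) ∧
        ((lev v + 1 = l ∧ b ≤ lev v) ∨ (lev v = l + 1 ∧ lev v < b + k)) := by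
      by_cases hb : lev v = b
      · exact ⟨lev v + 1, by omega, by omega⟩
      · exact ⟨lev v - 1, by omega, by omega⟩
    obtain ⟨y, hy, hyt, hyr⟩ := hrgv.exists_adjacent (by omega) hl1
    rw [← hy] at hl2
    obtain ⟨w, hw, hwt, hwr⟩ := hyr.exists_adjacent (by omega) hl2
    have := (hru s (by omega)).1
      (hwr.mono (by omega) (h.le_of_lt (Or.inr hw) (by omega)))
    omega
  omega

theorem IsHeight.of_consecutive_of_ne {g : V → ℕ} (hg : IsHeight lev t b k g)
    {u v : V} (h : Consecutive lev t u v) (hu : b ≤ lev u) (hu' : lev u < b + k)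
    (hv : b ≤ lev v) (hv' : lev v < b + k) (hl : lev u ≠ lev v) :
    g v = g u + 1 ∨ g v + 1 = g u := by
  obtain ⟨hgu, hru⟩ := hg u hu hu'
  obtain ⟨hgv, hrv⟩ := hg v hv hv'
  have hgub := hg.lev_le hu hu'
  have hgvb := hg.lev_le hv hv'
  have hl1 := h.2.1
  have hl2 := h.2.2.1
  have h1 : g v ≤ g u + 1 := by
    by_contra hcon
    obtain ⟨s, hs⟩ : ∃ s, g v = s + 1 := ⟨g v - 1, by omega⟩
    have hr := hg.reach hv hv'
    rw [hs] at hr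
    obtain ⟨w, hw, hwt, hwr⟩ := hr.exists_adjacent (l := lev u) (by omega) (by omega)
    have := (hru s (by omega)).1 (hwr.mono hw (h.le_of_lt (Or.inl hw) hwt))
    omega
  have h2 : g u ≤ g v + 1 := by
    by_contra hcon
    obtain ⟨s, hs⟩ : ∃ s, g u = s + 1 := ⟨g u - 1, by omega⟩
    have hr := hg.reach hu hu'
    rw [hs] at hr
    obtain ⟨w, hw, hwt, hwr⟩ := hr.exists_adjacent (l := lev v) (by omega) (by omega)
    have := (hrv s (by omega)).1 (hwr.mono hw (hwt.trans h.1).le)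
    omega
  omega

/-- `S` meets every pair of consecutive elements of which one is in `D` and one is not. -/
def Separates (lev t : V → ℕ) (D : Set V) (S : Finset V) : Prop :=
  ∀ u v, Consecutive lev t u v → ¬ (u ∈ D ↔ v ∈ D) → u ∈ S ∨ v ∈ S

/-- If the window contains no `k` by `k` interleaved grid, its bottom line is separated from its top
line by at most `3 * k` vertices: the grid elements on the critical path of the missing last grid
element. -/
theorem exists_separator_of_not_reach [Fintype V] (ht : Function.Injective t) (hk : 2 ≤ k)
    (hno : ∀ x, lev x + 1 = b + k → ¬ Reach lev t b k (3 * k - 1) x) :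
    ∃ (D : Set V) (S : Finset V), S.card ≤ 3 * k ∧ (∀ x, lev x ≤ b → x ∈ D) ∧
      (∀ x ∈ D, lev x + 1 < b + k) ∧ Separates lev t D S := by
  classical
  obtain ⟨g, hg⟩ := exists_isHeight lev t b hk
  obtain ⟨p, hpar, hstep, hpk, hlast, hcrit⟩ := exists_infinite_critical_path lev t b hk
  let Z : ℕ → Finset V := fun s => Finset.univ.filter fun x =>
    lev x = b + p s ∧ Reach lev t b k s x ∧
      ∀ y, lev y = lev x → Reach lev t b k s y → t x ≤ t y
  let S : Finset V := (Finset.range (3 * k)).biUnion Z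
  have hS : S.card ≤ 3 * k := by
    have := Finset.card_biUnion_le_card_mul (Finset.range (3 * k)) Z 1 (fun s _ => ?_)
    · simpa using this
    · refine Finset.card_le_one.2 fun x hx y hy => ht ?_
      simp only [Z, Finset.mem_filter, Finset.mem_univ, true_and] at hx hy
      exact le_antisymm (hx.2.2 y (by omega) hy.2.1) (hy.2.2 x (by omega) hx.2.1)
  have hmemS : ∀ s x, lev x < b + k → lev x = b + p s → Reach lev t b k s x →
      (∀ y, lev y = lev x → t y < t x → ¬ Reach lev t b k s y) → x ∈ S := by
    intro s x hxk hx hr hmin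
    refine Finset.mem_biUnion.2 ⟨s, Finset.mem_range.2 (hlast s (by omega)), ?_⟩
    simp only [Z, Finset.mem_filter, Finset.mem_univ, true_and]
    exact ⟨hx, hr, fun y hy hyr => not_lt.1 fun hlt => hmin y hy hlt hyr⟩
  let D : Set V := {x | lev x < b ∨ (lev x < b + k ∧ lev x < b + p (g x + 1))}
  have hDb : ∀ x, lev x ≤ b → x ∈ D := by
    intro x hx
    rcases hx.lt_or_eq with h | h
    · exact Or.inl h
    · refine Or.inr ⟨by omega, ?_⟩
      have := (hg x (by omega) (by omega)).1
      have := hpar (g x + 1)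
      omega
  have hDk : ∀ x ∈ D, lev x + 1 < b + k := by
    rintro x (hx | ⟨hx, hx'⟩)
    · omega
    · by_contra hcon
      have hx1 : lev x + 1 = b + k := by omega
      obtain ⟨h1, h2⟩ := hg x (by omega) hx
      have h3 := hno x hx1
      rw [h2 _ (by omega)] at h3
      have h4 := hpk (g x + 1) (by omega)
      omega
  refine ⟨D, S, hS, hDb, hDk, ?_⟩
  intro u v huv hD
  have hlt := huv.1
  have hl1 := huv.2.1
  have hl2 := huv.2.2.1
  have hDu := hDk u
  have hDv := hDk v
  have hbu := hDb u
  have hbv := hDb v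
  obtain ⟨hu, hv⟩ : (b ≤ lev u ∧ lev u < b + k) ∧ (b ≤ lev v ∧ lev v < b + k) := by
    by_cases huD : u ∈ D <;> by_cases hvD : v ∈ D <;> simp only [huD, hvD, iff_self, not_true,
      forall_true_left, imp_false] at hD hDu hDv hbu hbv <;> omega
  have huD : u ∈ D ↔ lev u < b + p (g u + 1) :=
    ⟨fun h => h.elim (fun h => by omega) fun h => h.2, fun h => Or.inr ⟨hu.2, h⟩⟩
  have hvD : v ∈ D ↔ lev v < b + p (g v + 1) :=
    ⟨fun h => h.elim (fun h => by omega) fun h => h.2, fun h => Or.inr ⟨hv.2, h⟩⟩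
  rw [huD, hvD] at hD
  clear hDu hDv hbu hbv huD hvD hDb hDk
  obtain ⟨hgu, hru⟩ := hg u hu.1 hu.2
  obtain ⟨hgv, hrv⟩ := hg v hv.1 hv.2
  have hrgu := hg.reach hu.1 hu.2
  have hrgv := hg.reach hv.1 hv.2
  by_cases hl : lev u = lev v
  · rcases hg.of_consecutive_of_eq hk huv hu.1 hu.2 hl with h3 | h3
    · rw [h3, hl] at hD
      exact absurd Iff.rfl hD
    -- `v` is the element of the critical path with index `g u + 2`
    rw [h3] at hrgv
    have p1 : p (g u + 2) = p (g u + 1) + 1 ∨ p (g u + 1) = p (g u + 2) + 1 := hstep (g u + 1)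
    have p2 : p (g u + 3) = p (g u + 2) + 1 ∨ p (g u + 2) = p (g u + 3) + 1 := hstep (g u + 2)
    have q2 := hpar (g u + 2)
    rw [show g v + 1 = g u + 3 by omega] at hD
    have hpv : lev v = b + p (g u + 2) := by omega
    clear hD p1 p2 q2
    refine Or.inr (hmemS (g u + 2) v hv.2 hpv hrgv fun w hw hwt hwr => ?_)
    have := (hru (g u + 2) (by omega)).1
      (hwr.mono (by omega) (huv.le_of_lt (Or.inr hw) hwt))
    omega
  · rcases hg.of_consecutive_of_ne huv hu.1 hu.2 hv.1 hv.2 hl with hgg | hgg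
    · -- `v` is the element of the critical path with index `g u + 1`
      rw [hgg] at hrgv
      have p1 : p (g u + 2) = p (g u + 1) + 1 ∨ p (g u + 1) = p (g u + 2) + 1 := hstep (g u + 1)
      have q1 := hpar (g u + 1)
      have q2 := hpar (g u + 2)
      rw [show g v + 1 = g u + 2 by omega] at hD
      have hpv : lev v = b + p (g u + 1) := by omega
      have hpu : lev u = b + p (g u + 2) := by omega
      clear hD p1 q1 q2
      refine Or.inr (hmemS (g u + 1) v hv.2 hpv hrgv fun w hw hwt hwr => ?_)
      have hle := huv.le_of_lt (Or.inr hw) hwt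
      have hne : t w ≠ t u := fun e => hl (by rw [← hw, ht e])
      have := (hru (g u + 2) (by omega)).1
        (hcrit (g u + 1) w u (by omega) hpu hu.2 hwr (by omega))
      omega
    · -- the boundary would cross the critical path without meeting it
      exfalso
      rw [hgg] at hD
      have p0 := hstep (g u)
      have q0 := hpar (g u)
      have q1 := hpar (g u + 1)
      have hpu : lev u = b + p (g u) := by omega
      have hpv : lev v = b + p (g u + 1) := by omega
      clear hD p0 q0 q1
      have := (hrv (g u + 1) (by omega)).1 (hcrit (g u) u v hpu hpv hv.2 hrgu hlt)
      omega

end Window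

/-! ### From an interleaved grid to the track -/

/-- An element of the top line that has reached the index of the last grid element gives a full
interleaved grid `X j i` (`j`-th element of line `i`), namely the greedy one. -/
theorem exists_grid {V : Type*} [Fintype V] {lev t : V → ℕ} {b k : ℕ} {x : V}
    (hx : lev x + 1 = b + k) (h : Reach lev t b k (3 * k - 1) x) (hk : 2 ≤ k) :
    ∃ X : ℕ → ℕ → V, (∀ j i, j < k → i < k → lev (X j i) = b + i) ∧
      (∀ j i, j < k → i + 1 < k → t (X j i) < t (X j (i + 1))) ∧
      ∀ j i, j + 1 < k → i + 1 < k → t (X j (i + 1)) < t (X (j + 1) i) := by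
  classical
  let N : ℕ → ℕ → Prop := fun j i => ∃ y, lev y = b + i ∧ Reach lev t b k (2 * j + i + 1 + 1) y
  have hleft : ∀ j i, i + 1 < k → N j (i + 1) → N j i := by
    rintro j i hi ⟨y, hy, hr⟩
    obtain ⟨z, hz, -, hzr⟩ := hr.exists_adjacent (l := b + i) (by omega) (by omega)
    exact ⟨z, hz, hzr⟩
  have hdown : ∀ j i, i + 1 < k → N (j + 1) i → N j (i + 1) := by
    rintro j i hi ⟨y, hy, hr⟩
    obtain ⟨z, hz, -, hzr⟩ := hr.exists_adjacent (l := b + (i + 1)) (by omega) (by omega)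
    exact ⟨z, hz, by convert hzr using 1; omega⟩
  have hrow : ∀ j, N j (k - 1) → ∀ d, d < k → N j (k - 1 - d) := by
    intro j hj d
    induction d with
    | zero => exact fun _ => hj
    | succ d ih =>
      intro hd
      refine hleft j _ (by omega) ?_
      rw [show k - 1 - (d + 1) + 1 = k - 1 - d by omega]
      exact ih (by omega)
  have hlast : ∀ d, d < k → N (k - 1 - d) (k - 1) := by
    intro d
    induction d with
    | zero => exact fun _ => ⟨x, by omega, by convert h using 1; omega⟩
    | succ d ih =>
      intro hd
      have h1 := hrow _ (ih (by omega)) 1 (by omega)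
      have h2 := hdown (k - 1 - (d + 1)) (k - 1 - 1) (by omega)
        (by rwa [show k - 1 - (d + 1) + 1 = k - 1 - d by omega])
      rwa [show k - 1 - 1 + 1 = k - 1 by omega] at h2
  have hN : ∀ j i, j < k → i < k → N j i := by
    intro j i hj hi
    have h1 := hlast (k - 1 - j) (by omega)
    have h2 := hrow _ h1 (k - 1 - i) (by omega)
    rwa [show k - 1 - (k - 1 - j) = j by omega, show k - 1 - (k - 1 - i) = i by omega] at h2
  have hfirst : ∀ j i, ∃ y, j < k → i < k → lev y = b + i ∧
      Reach lev t b k (2 * j + i + 1 + 1) y ∧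
      ∀ z, lev z = b + i → Reach lev t b k (2 * j + i + 1 + 1) z → t y ≤ t z := by
    intro j i
    by_cases hji : j < k ∧ i < k
    · obtain ⟨y, hy, hr⟩ := hN j i hji.1 hji.2
      obtain ⟨z, hz, hzmin⟩ := (Finset.univ.filter fun y => lev y = b + i ∧
        Reach lev t b k (2 * j + i + 1 + 1) y).exists_min_image t ⟨y, by simp [hy, hr]⟩
      simp only [Finset.mem_filter, Finset.mem_univ, true_and] at hz hzmin
      exact ⟨z, fun _ _ => ⟨hz.1, hz.2, fun u hu hur => hzmin u ⟨hu, hur⟩⟩⟩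
    · exact ⟨x, fun h1 h2 => absurd ⟨h1, h2⟩ hji⟩
  choose X hX using hfirst
  refine ⟨X, fun j i hj hi => (hX j i hj hi).1, fun j i hj hi => ?_, fun j i hj hi => ?_⟩
  · obtain ⟨h1, h2, -⟩ := hX j (i + 1) hj hi
    obtain ⟨-, -, h3⟩ := hX j i hj (by omega)
    obtain ⟨z, hz, hzt, hzr⟩ := h2.exists_adjacent (l := b + i) (by omega) (by omega)
    exact (h3 z hz hzr).trans_lt hzt
  · obtain ⟨h1, h2, -⟩ := hX (j + 1) i hj (by omega)
    obtain ⟨-, -, h3⟩ := hX j (i + 1) (by omega) hi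
    obtain ⟨z, hz, hzt, hzr⟩ := h2.exists_adjacent (l := b + (i + 1)) (by omega) (by omega)
    exact (h3 z hz (by convert hzr using 1; omega)).trans_lt hzt

/-- The line of the `k`-track containing its term at position `p`. -/
def trackLine (k p : ℕ) : ℕ :=
  if Odd k ∧ k ^ 2 - k ≤ p then k - 1 else 2 * (p / 2 / k) + p % 2

/-- The index of the term at position `p` of the `k`-track on its line. -/
def trackIndex (k p : ℕ) : ℕ :=
  if Odd k ∧ k ^ 2 - k ≤ p then p - (k ^ 2 - k) else p / 2 % k

/-- Sorts the grid elements by blocks of two lines, then by index, then by line; for `ε = 0` this is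
their order by position, and for `ε = 1` by value. -/
def gridKey (ε k i j : ℕ) : ℕ := (i + ε) / 2 * (2 * k) + 2 * j + (i + ε) % 2

theorem trackLine_lt {k p : ℕ} (hp : p < k ^ 2) : trackLine k p < k := by
  have hk : 0 < k := by
    rcases Nat.eq_zero_or_pos k with rfl | h
    · simp at hp
    · exact h
  have key : ∀ m, p < k * (2 * m) → 2 * (p / 2 / k) + p % 2 < 2 * m := by
    intro m hm
    have : p / 2 / k < m := by
      rw [Nat.div_lt_iff_lt_mul hk]
      have : k * (2 * m) = 2 * (m * k) := by ring
      omega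
    omega
  unfold trackLine
  rcases Nat.even_or_odd' k with ⟨m, hm | hm⟩
  · rw [if_neg (by rw [Nat.odd_iff]; omega)]
    have := key m (by rw [← hm, ← sq]; exact hp)
    omega
  · split_ifs with h
    · omega
    · have hlt : p < k ^ 2 - k := by
        by_contra h'
        exact h ⟨⟨m, hm⟩, by omega⟩
      have := key m (by
        rw [sq, ← Nat.mul_sub_one, hm, Nat.add_sub_cancel, ← hm] at hlt
        exact hlt)
      omega

theorem trackIndex_lt {k p : ℕ} (hp : p < k ^ 2) : trackIndex k p < k := by
  have hk : 0 < k := by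
    rcases Nat.eq_zero_or_pos k with rfl | h
    · simp at hp
    · exact h
  unfold trackIndex
  split_ifs with h
  · omega
  · exact Nat.mod_lt _ hk

theorem gridKey_track_lt {k p q : ℕ} (h : p < q) :
    gridKey 0 k (trackLine k p) (trackIndex k p) <
      gridKey 0 k (trackLine k q) (trackIndex k q) := by
  have key : ∀ p, gridKey 0 k (trackLine k p) (trackIndex k p) =
      if Odd k ∧ k ^ 2 - k ≤ p then k ^ 2 - k + 2 * (p - (k ^ 2 - k)) else p := by
    intro p
    unfold gridKey trackLine trackIndex
    split_ifs with h
    · obtain ⟨⟨m, hm⟩, -⟩ := h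
      have h1 : (k - 1 + 0) / 2 * (2 * k) = k ^ 2 - k := by
        rw [show (k - 1 + 0) / 2 = m by omega, sq, ← Nat.mul_sub_one, hm, Nat.add_sub_cancel]
        ring
      rw [h1]
      omega
    · have h1 := Nat.div_add_mod (p / 2) k
      rw [show (2 * (p / 2 / k) + p % 2 + 0) / 2 = p / 2 / k by omega,
        show p / 2 / k * (2 * k) = 2 * (k * (p / 2 / k)) by ring]
      omega
  rw [key, key]
  split_ifs with h1 h2 h2
  · omega
  · exact absurd ⟨h1.1, by omega⟩ h2
  · omega
  · exact h

theorem gridKey_track {k : ℕ} (p : Fin (k ^ 2)) :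
    gridKey 1 k (trackLine k p) (trackIndex k p) = trackSeq k p := by
  unfold gridKey trackLine trackIndex trackSeq
  split_ifs with h h2
  · obtain ⟨⟨m, hm⟩, -⟩ := h
    have h1 : (k - 1 + 1) / 2 * (2 * k) = k ^ 2 - k := by
      rw [show (k - 1 + 1) / 2 = m by omega, sq, ← Nat.mul_sub_one, hm, Nat.add_sub_cancel]
      ring
    rw [h1]
    omega
  · rw [Nat.even_iff] at h2
    have h1 := Nat.div_add_mod ((p : ℕ) / 2) k
    rw [h2, show (2 * ((p : ℕ) / 2 / k) + 0 + 1) / 2 = (p : ℕ) / 2 / k by omega,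
      show (p : ℕ) / 2 / k * (2 * k) = 2 * (k * ((p : ℕ) / 2 / k)) by ring]
    omega
  · rw [Nat.even_iff] at h2
    have h1 := Nat.div_add_mod ((p : ℕ) / 2) k
    rw [show (p : ℕ) % 2 = 1 by omega,
      show (2 * ((p : ℕ) / 2 / k) + 1 + 1) / 2 = (p : ℕ) / 2 / k + 1 by omega,
      show ((p : ℕ) / 2 / k + 1) * (2 * k) = 2 * (k * ((p : ℕ) / 2 / k)) + 2 * k by ring]
    omega

theorem reduction_lt_iff {n : ℕ} (ω : Fin n → ℕ) (hω : Function.Injective ω) (a b : Fin n) :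
    reduction ω hω a < reduction ω hω b ↔ ω a < ω b := by
  change rank ω a < rank ω b ↔ _
  refine ⟨fun h => ?_, rank_lt_rank ω⟩
  by_contra hcon
  rcases (not_lt.1 hcon).lt_or_eq with h1 | h1
  · exact lt_asymm h (rank_lt_rank ω h1)
  · rw [hω h1] at h
    exact lt_irrefl _ h

/-- An interleaved grid starting on an even level is a copy of the track. -/
theorem contains_track_of_grid {n b k : ℕ} {π : Equiv.Perm (Fin n)} {lev t : Fin n → ℕ}
    (hpos : IsLex lev t (fun x => (π.symm x : ℕ)) 0) (hval : IsLex lev t (fun x => (x : ℕ)) 1)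
    (hb : b % 2 = 0) (hk : 2 ≤ k) (X : ℕ → ℕ → Fin n)
    (hX : ∀ j i, j < k → i < k → lev (X j i) = b + i)
    (hup : ∀ j i, j < k → i + 1 < k → t (X j i) < t (X j (i + 1)))
    (hdown : ∀ j i, j + 1 < k → i + 1 < k → t (X j (i + 1)) < t (X (j + 1) i)) :
    Contains π (track k) := by
  have hsucc : ∀ i j, i < k → j + 1 < k → t (X j i) < t (X (j + 1) i) := by
    intro i j hi hj
    by_cases h : i + 1 < k
    · exact (hup j i (by omega) h).trans (hdown j i hj h)
    · obtain ⟨l, rfl⟩ : ∃ l, i = l + 1 := ⟨i - 1, by omega⟩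
      exact (hdown j l hj hi).trans (hup (j + 1) l hj hi)
  have hline : ∀ i j d, i < k → j + d < k → t (X j i) ≤ t (X (j + d) i) := by
    intro i j d hi
    induction d with
    | zero => exact fun _ => le_rfl
    | succ d ih => exact fun hd => (ih (by omega)).trans (hsucc i (j + d) hi hd).le
  have hblock : ∀ i j i' j', i < k → j < k → i' < k → j' < k → i ≤ i' + 1 → i' ≤ i + 1 →
      (j < j' ∨ j = j' ∧ i < i') → t (X j i) < t (X j' i') := by
    intro i j i' j' hi hj hi' hj' h1 h2 h
    rcases h with h | ⟨rfl, h⟩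
    · obtain ⟨d, rfl⟩ : ∃ d, j' = j + 1 + d := ⟨j' - (j + 1), by omega⟩
      refine lt_of_lt_of_le ?_ (hline i' (j + 1) d hi' hj')
      rcases (show i = i' ∨ i' = i + 1 ∨ i = i' + 1 by omega) with rfl | rfl | rfl
      · exact hsucc _ _ hi (by omega)
      · exact (hsucc _ _ hi (by omega)).trans (hup _ _ (by omega) hi')
      · exact hdown _ _ (by omega) hi
    · rw [show i' = i + 1 by omega] at hi' ⊢
      exact hup _ _ hj hi'
  have hkey : ∀ (key : Fin n → ℕ) (ε : ℕ), IsLex lev t key ε → ∀ i j i' j', i < k →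
      j < k → i' < k → j' < k → gridKey ε k i j < gridKey ε k i' j' →
      key (X j i) < key (X j' i') := by
    intro key ε hlex i j i' j' hi hj hi' hj' h
    rw [hlex, hX j i hj hi, hX j' i' hj' hi']
    unfold gridKey at h
    rcases lt_trichotomy ((i + ε) / 2) ((i' + ε) / 2) with h1 | h1 | h1
    · left
      omega
    · rw [h1] at h
      refine Or.inr ⟨by omega, hblock i j i' j' hi hj hi' hj' (by omega) (by omega) (by omega)⟩
    · exfalso
      have := Nat.mul_le_mul_right (2 * k) (Nat.succ_le_of_lt h1)
      rw [Nat.succ_mul] at this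
      omega
  let x : Fin (k ^ 2) → Fin n := fun p => X (trackIndex k p) (trackLine k p)
  have hxval : ∀ p q, trackSeq k p < trackSeq k q → x p < x q := by
    intro p q h
    rw [← gridKey_track, ← gridKey_track] at h
    exact hkey _ 1 hval _ _ _ _ (trackLine_lt p.2) (trackIndex_lt p.2) (trackLine_lt q.2)
      (trackIndex_lt q.2) h
  refine ⟨fun p => π.symm (x p), ?_, fun p q => ?_⟩
  · intro p q h
    exact hkey _ 0 hpos _ _ _ _ (trackLine_lt p.2) (trackIndex_lt p.2)
      (trackLine_lt q.2) (trackIndex_lt q.2) (gridKey_track_lt h)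
  · simp only [Equiv.apply_symm_apply, track, reduction_lt_iff]
    refine ⟨fun h => ?_, hxval p q⟩
    by_contra hcon
    rcases (not_lt.1 hcon).lt_or_eq with h1 | h1
    · exact lt_asymm h (hxval q p h1)
    · rw [trackSeq_injective k h1] at h
      exact lt_irrefl _ h

/-! ### Sweeping the permutation graph -/

theorem consecutive_of_key_eq_succ {V : Type*} {lev t key : V → ℕ} {ε : ℕ}
    (hlex : IsLex lev t key ε) {u v : V} (h : key v = key u + 1)
    (hl : (lev u + ε) / 2 = (lev v + ε) / 2) : Consecutive lev t u v := by
  have h1 := (hlex u v).1 (by omega)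
  refine ⟨by omega, by omega, by omega, fun w hw huw hwv => ?_⟩
  have hw' : (lev w + ε) / 2 = (lev u + ε) / 2 := by
    rcases hw with hw | hw
    · rw [hw]
    · rw [hw, hl]
  have h2 := (hlex u w).2 (by omega)
  have h3 := (hlex w v).2 (by omega)
  omega

/-- Elements consecutive for `key` but in different blocks are met by a set with one element, the
first one from there on, for each place where a block can begin. -/
theorem exists_seam {V : Type*} [Fintype V] {lev t key : V → ℕ} {ε : ℕ} (hε : ε ≤ 1)
    (hkey : Function.Injective key) (hlex : IsLex lev t key ε) {lo hi : ℕ}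
    (hlohi : lo ≤ hi) :
    ∃ S : Finset V, S.card ≤ hi / 2 + 2 - lo / 2 ∧ ∀ A : Set V, (∀ x, lev x < lo → x ∈ A) →
      (∀ x ∈ A, lev x < hi) → ∀ u v, key v = key u + 1 → (lev u + ε) / 2 ≠ (lev v + ε) / 2 →
      ¬ (u ∈ A ↔ v ∈ A) → v ∈ S := by
  classical
  let F : ℕ → Finset V := fun c => Finset.univ.filter fun x => c ≤ (lev x + ε) / 2 ∧
    ∀ y, c ≤ (lev y + ε) / 2 → key x ≤ key y
  refine ⟨(Finset.Icc (lo / 2) (hi / 2 + 1)).biUnion F, ?_, ?_⟩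
  · have := Finset.card_biUnion_le_card_mul (Finset.Icc (lo / 2) (hi / 2 + 1)) F 1 (fun c _ => ?_)
    · simpa using this
    · refine Finset.card_le_one.2 fun x hx y hy => hkey ?_
      simp only [F, Finset.mem_filter, Finset.mem_univ, true_and] at hx hy
      exact le_antisymm (hx.2 y hy.1) (hy.2 x hx.1)
  · intro A hlo hhi u v huv hne hA
    have h1 := (hlex u v).1 (by omega)
    obtain ⟨c, hc1, hc2, hc3, hc4⟩ : ∃ c, lo / 2 ≤ c ∧ c ≤ hi / 2 + 1 ∧ (lev u + ε) / 2 < c ∧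
        c ≤ (lev v + ε) / 2 := by
      by_cases hv : v ∈ A
      · have hu : u ∉ A := fun hu => hA (iff_of_true hu hv)
        have hv' := hhi v hv
        have hu' : ¬ lev u < lo := fun h => hu (hlo u h)
        exact ⟨(lev v + ε) / 2, by omega, by omega, by omega, le_rfl⟩
      · have hu : u ∈ A := by
          by_contra hu
          exact hA (iff_of_false hu hv)
        have hu' := hhi u hu
        have hv' : ¬ lev v < lo := fun h => hv (hlo v h)
        exact ⟨max (lo / 2) ((lev u + ε) / 2 + 1), by omega, by omega, by omega, by omega⟩
    refine Finset.mem_biUnion.2 ⟨c, Finset.mem_Icc.2 ⟨hc1, hc2⟩, ?_⟩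
    simp only [F, Finset.mem_filter, Finset.mem_univ, true_and]
    refine ⟨hc4, fun y hy => ?_⟩
    have := (hlex u y).2 (by omega)
    omega

theorem exists_cuts_of_separates {n : ℕ} {π : Equiv.Perm (Fin n)} {lev t : Fin n → ℕ}
    (hpos : IsLex lev t (fun x => (π.symm x : ℕ)) 0) (hval : IsLex lev t (fun x => (x : ℕ)) 1)
    {lo hi : ℕ} (hlohi : lo ≤ hi) {A : Set (Fin n)} {S : Finset (Fin n)} (hS : Separates lev t A S)
    (hlo : ∀ x, lev x < lo → x ∈ A) (hhi : ∀ x ∈ A, lev x < hi) :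
    ∃ S' : Finset (Fin n), S'.card ≤ S.card + 2 * (hi / 2 + 2 - lo / 2) ∧
      Cuts (permGraph π) A S' := by
  classical
  obtain ⟨S0, hS0, h0⟩ := exists_seam (by omega)
    (fun x y hxy => π.symm.injective (Fin.ext hxy)) hpos hlohi
  obtain ⟨S1, hS1, h1⟩ := exists_seam le_rfl (fun x y hxy => Fin.ext hxy) hval hlohi
  refine ⟨S ∪ S0 ∪ S1, ?_, ?_⟩
  · have h2 := Finset.card_union_le (S ∪ S0) S1
    have h3 := Finset.card_union_le S S0
    omega
  · have main : ∀ u v : Fin n, ((v : ℕ) = (u : ℕ) + 1 ∨ (π.symm v : ℕ) = (π.symm u : ℕ) + 1) →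
        ¬ (u ∈ A ↔ v ∈ A) → u ∈ S ∪ S0 ∪ S1 ∨ v ∈ S ∪ S0 ∪ S1 := by
      intro u v huv hA
      simp only [Finset.mem_union]
      rcases huv with huv | huv
      · by_cases hl : (lev u + 1) / 2 = (lev v + 1) / 2
        · have := hS u v (consecutive_of_key_eq_succ hval huv hl) hA
          tauto
        · have := h1 A hlo hhi u v huv hl hA
          tauto
      · by_cases hl : (lev u + 0) / 2 = (lev v + 0) / 2
        · have := hS u v (consecutive_of_key_eq_succ hpos huv hl) hA
          tauto
        · have := h0 A hlo hhi u v huv hl hA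
          tauto
    intro u v huv hu hv
    have hA : ¬ (u ∈ A ↔ v ∈ A) := fun h => hv (h.1 hu)
    have hA' : ¬ (v ∈ A ↔ u ∈ A) := fun h => hv (h.2 hu)
    have hcases : ((v : ℕ) = (u : ℕ) + 1 ∨ (π.symm v : ℕ) = (π.symm u : ℕ) + 1) ∨
        ((u : ℕ) = (v : ℕ) + 1 ∨ (π.symm u : ℕ) = (π.symm v : ℕ) + 1) := by
      rcases huv with huv | huv <;> rcases abs_eq (by norm_num) |>.1 huv with h | h <;> omega
    rcases hcases with h | h
    · exact main u v h hA
    · exact (main v u h hA').symm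

/-- Between two separated sets `D` and `D'` that differ in a bounded window only, one can sweep
from left to right: the boundary of the sweep line has at most one element on each level. -/
theorem Separates.exists_sweep {V : Type*} [Fintype V] {lev t : V → ℕ}
    (ht : Function.Injective t) {D D' : Set V} {S S' : Finset V} (hD : Separates lev t D S)
    (hD' : Separates lev t D' S') {lo hi : ℕ}
    (hw : ∀ x ∈ D', x ∉ D → lo ≤ lev x ∧ lev x < hi) (q : ℕ) :
    ∃ S'' : Finset V, S''.card ≤ S.card + S'.card + (hi - lo) ∧
      Separates lev t (D ∪ (D' ∩ {x | t x < q})) S'' := by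
  classical
  let F : ℕ → Finset V := fun l => Finset.univ.filter fun x => lev x = l ∧ t x < q ∧
    ∀ y, lev y = l → t y < q → t y ≤ t x
  have hF : ((Finset.Ico lo hi).biUnion F).card ≤ hi - lo := by
    have := Finset.card_biUnion_le_card_mul (Finset.Ico lo hi) F 1 (fun c _ => ?_)
    · simpa using this
    · refine Finset.card_le_one.2 fun x hx y hy => ht ?_
      simp only [F, Finset.mem_filter, Finset.mem_univ, true_and] at hx hy
      exact le_antisymm (hy.2.2 x hx.1 hx.2.1) (hx.2.2 y hy.1 hy.2.1)
  refine ⟨S ∪ S' ∪ (Finset.Ico lo hi).biUnion F, ?_, ?_⟩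
  · have h2 := Finset.card_union_le (S ∪ S') ((Finset.Ico lo hi).biUnion F)
    have h3 := Finset.card_union_le S S'
    omega
  · intro u v huv hA
    simp only [Finset.mem_union]
    by_cases h1 : u ∈ D ↔ v ∈ D
    swap
    · have := hD u v huv h1
      tauto
    by_cases h2 : u ∈ D' ↔ v ∈ D'
    swap
    · have := hD' u v huv h2
      tauto
    simp only [Set.mem_union, Set.mem_inter_iff, Set.mem_ofPred_eq] at hA
    have huD : u ∉ D := by tauto
    have huD' : u ∈ D' := by tauto
    have hq : t u < q ∧ q ≤ t v := by
      have := huv.1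
      by_cases hu : t u < q <;> by_cases hv : t v < q
      · tauto
      · omega
      · omega
      · tauto
    refine Or.inl (Or.inr (Finset.mem_biUnion.2 ⟨lev u, Finset.mem_Ico.2 (hw u huD' huD), ?_⟩))
    simp only [F, Finset.mem_filter, Finset.mem_univ, true_and]
    exact ⟨hq.1, fun y hy hyq => huv.le_of_lt (Or.inl hy) (by omega)⟩

theorem contains_track_of_containsWall {n k r : ℕ} {π : Equiv.Perm (Fin n)} (hk : 2 ≤ k)
    (hr : 32 * k + 3 ≤ r) (h : Avoids321 π) (hwall : ContainsWall (permGraph π) r) :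
    Contains π (track k) := by
  by_contra hno
  obtain ⟨lev, t, ht, hpos, hval⟩ := h.exists_staircase
  have hsep : ∀ w : ℕ, ∃ (D : Set (Fin n)) (S : Finset (Fin n)), S.card ≤ 3 * k ∧
      (∀ x, lev x ≤ 2 * k * w → x ∈ D) ∧ (∀ x ∈ D, lev x + 1 < 2 * k * w + k) ∧
      Separates lev t D S := by
    intro w
    refine exists_separator_of_not_reach ht hk fun x hx hreach => hno ?_
    obtain ⟨X, hX, hup, hdown⟩ := exists_grid hx hreach hk
    exact contains_track_of_grid hpos hval (by rw [mul_assoc]; omega) hk X hX hup hdown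
  choose D S hScard hDlo hDhi hDS using hsep
  obtain ⟨Q, hQ0, hQ1, hQ⟩ := exists_small_of_containsWall (B := 16 * k) hwall (by omega)
  -- one step of the sweep, from a small set `E` to the set `D w`
  have hsweep : ∀ (w lo : ℕ) (E : Set (Fin n)) (T : Finset (Fin n)), T.card ≤ 3 * k →
      Separates lev t E T → (∀ x, lev x < lo → x ∈ E) → E ⊆ D w → 2 * k * w + 2 * k ≤ lo + 4 * k →
      lo ≤ 2 * k * w → lo % 2 = 0 → Q E → Q (D w) := by
    intro w lo E T hT hE hlo hED hlo' hlo'' hpar hQE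
    have hq : ∀ q, Q (E ∪ (D w ∩ {x | t x < q})) := by
      intro q
      induction q with
      | zero => simpa using hQE
      | succ q ih =>
        by_cases hv : ∃ v, t v = q
        · obtain ⟨v, hv⟩ := hv
          refine hQ _ _ v ih ?_ ?_
          · rintro x (hx | ⟨hx, hxt⟩)
            · exact Or.inr (Or.inl hx)
            · rcases (Nat.lt_succ_iff.1 hxt).lt_or_eq with h1 | h1
              · exact Or.inr (Or.inr ⟨hx, h1⟩)
              · exact Or.inl (ht (h1.trans hv.symm))
          · obtain ⟨T', hT', hsep⟩ := hE.exists_sweep ht (hDS w) (lo := lo)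
              (hi := 2 * k * w + 2 * k) (fun x hx hxE => ⟨not_lt.1 fun hlt => hxE (hlo x hlt), by
                have := hDhi w x hx
                omega⟩) (q + 1)
            obtain ⟨T'', hT'', hcut⟩ := exists_cuts_of_separates hpos hval (lo := lo)
              (hi := 2 * k * w + 2 * k) (by omega) hsep (fun x hx => Or.inl (hlo x hx)) (by
                rintro x (hx | ⟨hx, -⟩)
                · have := hDhi w x (hED hx)
                  omega
                · have := hDhi w x hx
                  omega)
            refine ⟨T'', ?_, hcut⟩
            have := hScard w
            generalize 2 * k * w = m at *
            omega
        · convert ih using 3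
          ext x
          simp only [Set.mem_ofPred_eq]
          have : t x ≠ q := fun hx => hv ⟨x, hx⟩
          omega
    have hfin : E ∪ (D w ∩ {x | t x < Finset.univ.sup t + 1}) = D w := by
      ext x
      constructor
      · rintro (hx | hx)
        · exact hED hx
        · exact hx.1
      · exact fun hx => Or.inr ⟨hx, Nat.lt_succ_of_le (Finset.le_sup (Finset.mem_univ x))⟩
    rw [← hfin]
    exact hq _
  have hall : ∀ w, Q (D w) := by
    intro w
    induction w with
    | zero =>
      exact hsweep 0 0 ∅ ∅ (by simp) (fun u v _ hne => absurd Iff.rfl hne) (by simp)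
        (Set.empty_subset _) (by omega) (by omega) rfl hQ0
    | succ w ih =>
      have hmul : 2 * k * (w + 1) = 2 * k * w + 2 * k := by ring
      refine hsweep (w + 1) (2 * k * w) (D w) (S w) (hScard w) (hDS w)
        (fun x hx => hDlo w x hx.le) (fun x hx => hDlo (w + 1) x ?_) (by omega)
        (by omega) (by rw [mul_assoc]; omega) ih
      have := hDhi w x hx
      omega
  refine hQ1 ?_
  have huniv : D (Finset.univ.sup lev) = Set.univ := by
    refine Set.eq_univ_of_forall fun x => hDlo _ x ?_
    have h1 : lev x ≤ Finset.univ.sup lev := Finset.le_sup (Finset.mem_univ x)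
    exact h1.trans (Nat.le_mul_of_pos_left _ (by omega))
  rw [← huniv]
  exact hall _

theorem contains_track_zero {n : ℕ} (π : Equiv.Perm (Fin n)) : Contains π (track 0) :=
  ⟨fun a => absurd a.2 (by simp), fun a => absurd a.2 (by simp), fun a => absurd a.2 (by simp)⟩

theorem contains_track_one {n : ℕ} (π : Equiv.Perm (Fin n)) (x : Fin n) :
    Contains π (track 1) := by
  have : Subsingleton (Fin (1 ^ 2)) := by
    rw [one_pow]
    infer_instance
  refine ⟨fun _ => x, fun a b hab => ?_, fun a b => ?_⟩
  · exact absurd (Subsingleton.elim a b) hab.ne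
  · rw [Subsingleton.elim a b]
    simp

theorem contains_track_of_rpow_le {k r n : ℕ} (hr2 : 2 ≤ r)
    (hr : 300 * (k : ℝ) ^ (3 / 2 : ℝ) ≤ (r : ℝ)) (π : Equiv.Perm (Fin n)) (h : Avoids321 π)
    (hwall : ContainsWall (permGraph π) r) : Contains π (track k) := by
  rcases (show k = 0 ∨ k = 1 ∨ 2 ≤ k by omega) with rfl | rfl | hk
  · exact contains_track_zero π
  · obtain ⟨f, -⟩ := hwall
    refine contains_track_one π (f ⟨(1, 1), ?_⟩)
    simp only [wallVerts, Set.mem_ofPred_eq, ne_eq, Prod.mk.injEq]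
    omega
  · have h1 : (k : ℝ) ≤ (k : ℝ) ^ (3 / 2 : ℝ) := by
      have hk1 : (1 : ℝ) ≤ k := by exact_mod_cast (by omega : 1 ≤ k)
      calc (k : ℝ) = (k : ℝ) ^ (1 : ℝ) := (Real.rpow_one _).symm
        _ ≤ (k : ℝ) ^ (3 / 2 : ℝ) := Real.rpow_le_rpow_of_exponent_le hk1 (by norm_num)
    have h2 : (300 * k : ℝ) ≤ r := by linarith
    have h3 : 300 * k ≤ r := by exact_mod_cast h2
    exact contains_track_of_containsWall hk (by omega) h hwall

end PermPattern

theorem mainTheorem7 :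
    (∃ g : ℕ → ℕ,
      (fun k : ℕ => (g k : ℝ)) =O[atTop] (fun k : ℕ => (k : ℝ) ^ (3 / 2 : ℝ)) ∧
      (∀ k : ℕ, 2 ≤ g k ∧ Even (g k)) ∧
      ∀ (k n : ℕ) (π : Equiv.Perm (Fin n)), PermPattern.Avoids321 π →
        PermPattern.ContainsWall (PermPattern.permGraph π) (g k) →
        PermPattern.Contains π (PermPattern.track k)) ∧
    (∀ k r : ℕ, 2 ≤ r → Even r → 300 * (k : ℝ) ^ (3 / 2 : ℝ) ≤ (r : ℝ) →
      ∀ (n : ℕ) (π : Equiv.Perm (Fin n)), PermPattern.Avoids321 π →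
        PermPattern.ContainsWall (PermPattern.permGraph π) r →
        PermPattern.Contains π (PermPattern.track k)) := by
  refine ⟨⟨fun k => 2 * (⌈150 * (k : ℝ) ^ (3 / 2 : ℝ)⌉₊ + 1), ?_, fun k => ⟨?_, by simp⟩,
    fun k n π h hwall => ?_⟩,
    fun k r hr2 _ hr n π h hwall => PermPattern.contains_track_of_rpow_le hr2 hr π h hwall⟩
  · refine IsBigO.of_bound 304 ?_
    filter_upwards [eventually_ge_atTop 1] with k hk
    have h1 : (1 : ℝ) ≤ (k : ℝ) ^ (3 / 2 : ℝ) :=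
      Real.one_le_rpow (by exact_mod_cast hk) (by norm_num)
    have h2 := (Nat.ceil_lt_add_one
      (show (0 : ℝ) ≤ 150 * (k : ℝ) ^ (3 / 2 : ℝ) by positivity)).le
    rw [Real.norm_of_nonneg (by positivity), Real.norm_of_nonneg (by positivity)]
    push_cast
    linarith
  · exact Nat.le_mul_of_pos_right 2 (Nat.succ_pos _)
  · refine PermPattern.contains_track_of_rpow_le (Nat.le_mul_of_pos_right 2 (Nat.succ_pos _))
      ?_ π h hwall
    have h2 := Nat.le_ceil (150 * (k : ℝ) ^ (3 / 2 : ℝ))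
    push_cast
    linarith
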